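/- Let $\kappa_1<\kappa_2$ be non-zero reals and $a>0$. For $x=(x_1,x_2)\in\mathbb R^2$ and $\mu\in\mathbb C$ put $\theta_j(x)=\kappa_jx_1+\kappa_j^2x_2$, $\tau=e^{\theta_1}+ae^{\theta_2}$, $$\chi(x,\mu)=\frac{(1-\frac{\kappa_1}{\mu})e^{\theta_1}+(1-\frac{\kappa_2}{\mu})ae^{\theta_2}}{\tau},\qquad \xi(x,\mu)=\frac1\tau\Big(\frac{e^{\theta_1}}{1-\frac{\kappa_1}{\mu}}+\frac{ae^{\theta_2}}{1-\frac{\kappa_2}{\mu}}\Big),$$ $\varphi=e^{\mu x_1+\mu^2x_2}\chi$, $\psi=e^{-(\mu x_1+\mu^2x_2)}\xi$, and $$\varphi_j(x)=\varphi(x,\kappa_j)=e^{\kappa_jx_1+\kappa_j^2x_2}\chi_j(x),\qquad \psi_j(x)=\operatorname{res}_{\mu=\kappa_j}\psi(x,\mu)=e^{-(\kappa_jx_1+\kappa_j^2x_2)}\xi_j(x).$$ Let $\theta$ be the Heaviside function with $\theta(0)=\frac12$. For $\lambda=\lambda_R+i\lambda_I\in\mathbb C$ let $G$ be the Green function of $-\partial_{x_2}+\partial_{x_1}^2+2\lambda\partial_{x_1}+u_0$,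 $u_0=\frac{(\kappa_1-\kappa_2)^2}{2}\operatorname{sech}^2\frac{\theta_1-\theta_2-\ln a}{2}$, given by $\mathcal G(x,x',\lambda)=e^{\lambda(x_1-x_1')+\lambda^2(x_2-x_2')}G(x,x',\lambda)$ and $$\mathcal G=-\frac{\operatorname{sgn}(x_2-x_2')}{2\pi}\,\mathrm{p.v.}\!\!\int_{\mathbb R}\theta\big((s^2-\lambda_I^2)(x_2-x_2')\big)\varphi(x,\lambda_R+is)\psi(x',\lambda_R+is)\,ds-\theta(x_2'-x_2)\sum_{j=1}^2\theta(\lambda_R-\kappa_j)\varphi_j(x)\psi_j(x'),$$ where the principal value, taken at $s=0$, is needed only if $\lambda_R\in\{\kappa_1,\kappa_2\}$. Let $D^\times_{\kappa_j}=\{\lambda:0<|\lambda-\kappa_j|<\kappa\}$ with $\kappa=\frac12\min\{|\kappa_1|,|\kappa_2|,\kappa_2-\kappa_1\}$, and for $(p,q)\neq(0,0)$ let $\cot^{-1}\frac p{|q|}\in[0,\pi]$ be the argument of $p+i|q|$ (so for $q=0$ it is $0$ if $p>0$ and $\pi$ if $p<0$). Write $|x|=|x_1|+|x_2|$. Then: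 (1) $G(x,x',\lambda)=\overline{G(x,x',\overline\lambda)}$ for all $x,x'\in\mathbb R^2$, $\lambda\in\mathbb C$. (2) There exist functions $\mathfrak G_j(x,x')$ and $\omega_j(x,x',\lambda)$, $j=1,2$, and a constant $C$ (depending only on $\kappa_1,\kappa_2,a$) such that for all $x,x'$ with $x_2\ne x_2'$ $$G(x,x',\lambda)=\begin{cases}\mathfrak G_1(x,x')+\frac1\pi\chi_1(x)\xi_1(x')\cot^{-1}\frac{\lambda_R-\kappa_1}{|\lambda_I|}+\omega_1(x,x',\lambda),&\lambda\in D^\times_{\kappa_1},\\[2pt] \mathfrak G_2(x,x')-\frac1\pi\chi_2(x)\xi_2(x')\cot^{-1}\frac{\kappa_2-\lambda_R}{|\lambda_I|}+\omega_2(x,x',\lambda),&\lambda\in D^\times_{\kappa_2},\end{cases}$$ and, for $j=1,2$ and $\lambda\in D_{\kappa_j}^\times$, $$|\mathfrak G_j(x,x')|,\ |\omega_j(x,x',\lambda)|\le C\Big(1+\frac1{\sqrt{|x_2-x_2'|}}\Big),\qquad \Big|\frac{\omega_j(x,x',\lambda)}{\lambda-\kappa_j}\Big|\le C\Big(1+\frac1{\sqrt{|x_2-x_2'|}}\Big)(1+|x'-x|),$$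 $$\mathfrak G_2(x,x')e^{\kappa_2(x_1-x_1')+\kappa_2^2(x_2-x_2')}=e^{\kappa_1(x_1-x_1')+\kappa_1^2(x_2-x_2')}\mathfrak G_1(x,x').$$ (3) For all $x,x'$ with $x_2\neq x_2'$ and all $\alpha\in\mathbb R$, the limits $G(x,x',\kappa_2+0^+e^{i\alpha})=\lim_{r\to0^+}G(x,x',\kappa_2+re^{i\alpha})$ and $G(x,x',\kappa_1+0^+e^{i(\pi+\alpha)})$ exist and $$G(x,x',\kappa_2+0^+e^{i\alpha})e^{\kappa_2(x_1-x_1')+\kappa_2^2(x_2-x_2')}=e^{\kappa_1(x_1-x_1')+\kappa_1^2(x_2-x_2')}G(x,x',\kappa_1+0^+e^{i(\pi+\alpha)}).$$ -/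

import Mathlib

open Filter Topology MeasureTheory

noncomputable section

namespace KPGreen

/-- The phase `μ x₁ + μ² x₂`. -/
def phase (μ : ℂ) (x : ℝ × ℝ) : ℂ := μ * x.1 + μ ^ 2 * x.2

/-- `θ_j(x) = κ_j x₁ + κ_j² x₂` (at `x₃ = 0`). -/
def theta (k : ℝ) (x : ℝ × ℝ) : ℝ := k * x.1 + k ^ 2 * x.2

/-- The tau function `τ(x) = e^{θ₁} + a e^{θ₂}`. -/
def tau (κ₁ κ₂ a : ℝ) (x : ℝ × ℝ) : ℝ :=
  Real.exp (theta κ₁ x) + a * Real.exp (theta κ₂ x)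

/-- The Sato normalized eigenfunction `χ(x, μ)`. -/
def chi (κ₁ κ₂ a : ℝ) (x : ℝ × ℝ) (μ : ℂ) : ℂ :=
  ((1 - κ₁ / μ) * Real.exp (theta κ₁ x) + (1 - κ₂ / μ) * (a * Real.exp (theta κ₂ x)))
    / tau κ₁ κ₂ a x

/-- The Sato eigenfunction `φ(x, μ) = e^{μ x₁ + μ² x₂} χ(x, μ)`. -/
def phi (κ₁ κ₂ a : ℝ) (x : ℝ × ℝ) (μ : ℂ) : ℂ :=
  Complex.exp (phase μ x) * chi κ₁ κ₂ a x μ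

/-- The Sato normalized adjoint eigenfunction `ξ(x, μ)`. -/
def xi (κ₁ κ₂ a : ℝ) (x : ℝ × ℝ) (μ : ℂ) : ℂ :=
  (Real.exp (theta κ₁ x) / (1 - κ₁ / μ) + a * Real.exp (theta κ₂ x) / (1 - κ₂ / μ))
    / tau κ₁ κ₂ a x

/-- The Sato adjoint eigenfunction `ψ(x, μ) = e^{-(μ x₁ + μ² x₂)} ξ(x, μ)`. -/
def psi (κ₁ κ₂ a : ℝ) (x : ℝ × ℝ) (μ : ℂ) : ℂ :=
  Complex.exp (-phase μ x) * xi κ₁ κ₂ a x μ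

/-- The residue of `f` at a (at most simple) pole `z`. -/
def simpleResidue (f : ℂ → ℂ) (z : ℂ) : ℂ :=
  limUnder (𝓝[≠] z) fun μ => (μ - z) * f μ

/-- `φ_j(x) = φ(x, κ_j)`, with `k = κ_j`. -/
def phiAt (κ₁ κ₂ a k : ℝ) (x : ℝ × ℝ) : ℂ := phi κ₁ κ₂ a x k

/-- `ψ_j(x) = res_{μ = κ_j} ψ(x, μ)`, with `k = κ_j`. -/
def psiAt (κ₁ κ₂ a k : ℝ) (x : ℝ × ℝ) : ℂ := simpleResidue (psi κ₁ κ₂ a x) k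

/-- `χ_j(x)`, defined by `φ_j(x) = e^{κ_j x₁ + κ_j² x₂} χ_j(x)`. -/
def chiAt (κ₁ κ₂ a k : ℝ) (x : ℝ × ℝ) : ℂ := Complex.exp (-phase k x) * phiAt κ₁ κ₂ a k x

/-- `ξ_j(x)`, defined by `ψ_j(x) = e^{-(κ_j x₁ + κ_j² x₂)} ξ_j(x)`. -/
def xiAt (κ₁ κ₂ a k : ℝ) (x : ℝ × ℝ) : ℂ := Complex.exp (phase k x) * psiAt κ₁ κ₂ a k x

/-- The Heaviside function, with the symmetric value `1/2` at the jump. -/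
def heaviside (t : ℝ) : ℝ := if t < 0 then 0 else if t = 0 then 1 / 2 else 1

/-- The integral over the line, as a principal value at the origin (for an integrable
function this is the ordinary integral). -/
def pvIntegral (F : ℝ → ℂ) : ℂ :=
  limUnder (𝓝[>] (0 : ℝ)) fun ε => ∫ s in {s : ℝ | ε < |s|}, F s

/-- The continuous part `𝒢_c` of the Green function. The integrand can only be singular at
`s = 0`, and only when `Re l` is `κ₁` or `κ₂`; the principal value matters only there. -/
def calGreenC (κ₁ κ₂ a : ℝ) (x x' : ℝ × ℝ) (l : ℂ) : ℂ :=
  -(Real.sign (x.2 - x'.2) / (2 * Real.pi) : ℝ) *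
    pvIntegral fun s : ℝ =>
      (heaviside ((s ^ 2 - l.im ^ 2) * (x.2 - x'.2)) : ℂ) *
        phi κ₁ κ₂ a x (l.re + Complex.I * s) * psi κ₁ κ₂ a x' (l.re + Complex.I * s)

/-- The discrete part `𝒢_d` of the Green function. -/
def calGreenD (κ₁ κ₂ a : ℝ) (x x' : ℝ × ℝ) (l : ℂ) : ℂ :=
  -(heaviside (x'.2 - x.2) : ℂ) *
    ((heaviside (l.re - κ₁) : ℂ) * phiAt κ₁ κ₂ a κ₁ x * psiAt κ₁ κ₂ a κ₁ x' +
      (heaviside (l.re - κ₂) : ℂ) * phiAt κ₁ κ₂ a κ₂ x * psiAt κ₁ κ₂ a κ₂ x')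

/-- The Green function `𝒢` of `-∂_{x₂} + ∂_{x₁}² + u₀`. -/
def calGreen (κ₁ κ₂ a : ℝ) (x x' : ℝ × ℝ) (l : ℂ) : ℂ :=
  calGreenC κ₁ κ₂ a x x' l + calGreenD κ₁ κ₂ a x x' l

/-- The Green function `G` of `-∂_{x₂} + ∂_{x₁}² + 2 l ∂_{x₁} + u₀`:
`𝒢(x, x', l) = e^{l (x₁ - x₁') + l² (x₂ - x₂')} G(x, x', l)`. -/
def green (κ₁ κ₂ a : ℝ) (x x' : ℝ × ℝ) (l : ℂ) : ℂ :=
  Complex.exp (-phase l (x - x')) * calGreen κ₁ κ₂ a x x' l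

/-- The radius `κ = ½ min {|κ₁|, |κ₂|, κ₂ - κ₁}`. -/
def radius (κ₁ κ₂ : ℝ) : ℝ := min (min |κ₁| |κ₂|) (κ₂ - κ₁) / 2

/-- The punctured disc `D_k^×` about `k`. -/
def puncturedDisc (κ₁ κ₂ k : ℝ) : Set ℂ := {l | 0 < ‖l - k‖ ∧ ‖l - k‖ < radius κ₁ κ₂}

/-- `cot⁻¹ (p / |q|) ∈ [0, π]` for `(p, q) ≠ (0, 0)`: the angle of the point `(p, |q|)` of the
closed upper half plane. For `q = 0` it is `0` if `p > 0` and `π` if `p < 0`. -/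
def arccotAbs (p q : ℝ) : ℝ := Complex.arg (p + |q| * Complex.I)

/-- The weight `1 + 1 / √|x₂ - x₂'|`. -/
def weight (x x' : ℝ × ℝ) : ℝ := 1 + 1 / Real.sqrt |x.2 - x'.2|

/-- The distance `|x' - x| = |x₁' - x₁| + |x₂' - x₂|`. -/
def dist₁ (x x' : ℝ × ℝ) : ℝ := |x'.1 - x.1| + |x'.2 - x.2|

end KPGreen

end

open KPGreen

/-!
The product `χ(x, μ) ξ(x', μ)` is `1 + c₁ / (μ - κ₁) + c₂ / (μ - κ₂)`, with real residues of modulus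
at most `κ₂ - κ₁` which satisfy `c₁ E₁ + c₂ E₂ = 0`, where
`E_j = e^{κ_j (x₁ - x₁') + κ_j² (x₂ - x₂')}`. Only the part of the integrand even in `s` contributes
to the principal value. Evaluating its integral over the whole line by Gaussian and error functions,
the jumps of the latter across `Re λ = κ_j` combine with the discrete part, and `𝒢` becomes a
background independent of `λ`, plus a combination of `sgn (Re λ - κ_j)`, plus the integral over the
segment from `Re λ` to `λ`. All of this is invariant under exchanging the two poles, and the
background is common to both expansions; hence the relations between them.

Near `κ_j` the polar part `c_j / (μ - κ_j)` integrates along the segment to an arctangent, which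
together with the sign jumps is the `cot⁻¹` term. The rest of the integrand is of size
`O(1 + |x - x'|)` on a segment of length at most `|λ - κ_j|` as long as `|λ - κ_j| (1 + |x - x'|)`
is small; otherwise the uniform bound on `G` suffices.
-/

noncomputable section

namespace KPGreen

/-! ### Oscillatory integrals with monotone weights -/

section MonotoneWeight

variable {u u' f : ℝ → ℝ} {a b M : ℝ}

lemma integral_abs_deriv_le_of_sign
    (hu : ∀ s ∈ Set.uIcc a b, HasDerivAt u (u' s) s) (hu' : IntervalIntegrable u' volume a b)
    (hsign : (∀ s ∈ Set.uIcc a b, 0 ≤ u' s) ∨ ∀ s ∈ Set.uIcc a b, u' s ≤ 0) :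
    ∫ s in a..b, |u' s| ≤ |u b - u a| := by
  have hval := intervalIntegral.integral_eq_sub_of_hasDerivAt hu hu'
  rcases hsign with h | h
  · rw [intervalIntegral.integral_congr fun s hs => abs_of_nonneg (h s hs), hval]
    exact le_abs_self _
  · rw [intervalIntegral.integral_congr fun s hs => abs_of_nonpos (h s hs),
      intervalIntegral.integral_neg, hval]
    exact neg_le_abs _

/-- Integration by parts against the primitive of `f`: the total variation of the monotone
weight `u` is `|u b - u a|`. -/
lemma abs_integral_mul_le_of_deriv_sign (hab : a ≤ b)
    (hu : ∀ s ∈ Set.uIcc a b, HasDerivAt u (u' s) s) (hu' : ContinuousOn u' (Set.uIcc a b))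
    (hsign : (∀ s ∈ Set.uIcc a b, 0 ≤ u' s) ∨ ∀ s ∈ Set.uIcc a b, u' s ≤ 0)
    (hf : IntervalIntegrable f volume a b) (hfc : ContinuousOn f (Set.Ioo a b))
    (hM : ∀ t ∈ Set.Icc a b, |∫ s in a..t, f s| ≤ M) :
    |∫ s in a..b, u s * f s| ≤ M * (|u b| + |u b - u a|) := by
  set F : ℝ → ℝ := fun t => ∫ s in a..t, f s
  have hF_cont : ContinuousOn F (Set.uIcc a b) :=
    intervalIntegral.continuousOn_primitive_interval <| by
      rwa [Set.uIcc_of_le hab, ← intervalIntegrable_iff_integrableOn_Icc_of_le hab]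
  have hF_deriv : ∀ s ∈ Set.Ioo (min a b) (max a b), HasDerivAt F (f s) s := by
    rw [min_eq_left hab, max_eq_right hab]
    intro s hs
    refine intervalIntegral.integral_hasDerivAt_right
      (hf.mono_set <| by
        rw [Set.uIcc_of_le hs.1.le, Set.uIcc_of_le hab]
        exact Set.Icc_subset_Icc_right hs.2.le)
      (hfc.stronglyMeasurableAtFilter isOpen_Ioo s hs) (hfc.continuousAt (Ioo_mem_nhds hs.1 hs.2))
  have hparts := intervalIntegral.integral_mul_deriv_eq_deriv_mul_of_hasDerivAt
    (fun s hs => (hu s hs).continuousAt.continuousWithinAt) hF_cont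
    (fun s hs => hu s (Set.Ioo_subset_Icc_self hs)) hF_deriv hu'.intervalIntegrable hf
  have hremainder : |∫ s in a..b, u' s * F s| ≤ M * |u b - u a| := calc
    |∫ s in a..b, u' s * F s| ≤ ∫ s in a..b, M * |u' s| := by
      rw [← Real.norm_eq_abs]
      refine intervalIntegral.norm_integral_le_of_norm_le hab
        (Eventually.of_forall fun s hs => ?_)
        ((hu'.abs.intervalIntegrable (μ := volume)).const_mul M)
      rw [norm_mul, mul_comm]
      exact mul_le_mul_of_nonneg_right (hM s ⟨hs.1.le, hs.2⟩) (abs_nonneg _)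
    _ = M * ∫ s in a..b, |u' s| := intervalIntegral.integral_const_mul M _
    _ ≤ M * |u b - u a| := mul_le_mul_of_nonneg_left
      (integral_abs_deriv_le_of_sign hu hu'.intervalIntegrable hsign)
      ((abs_nonneg _).trans (hM a ⟨le_rfl, hab⟩))
  have hboundary : |u b * F b| ≤ M * |u b| := by
    rw [abs_mul, mul_comm]
    exact mul_le_mul_of_nonneg_right (hM b ⟨hab, le_rfl⟩) (abs_nonneg _)
  have hFa : F a = 0 := intervalIntegral.integral_same
  rw [hparts, hFa, mul_zero, sub_zero]
  linarith [abs_sub (u b * F b) (∫ s in a..b, u' s * F s)]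

lemma abs_integral_mul_le_two_mul_of_deriv_sign (hab : a ≤ b)
    (hu : ∀ s ∈ Set.uIcc a b, HasDerivAt u (u' s) s) (hu' : ContinuousOn u' (Set.uIcc a b))
    (hsign : (∀ s ∈ Set.uIcc a b, 0 ≤ u' s) ∨ ∀ s ∈ Set.uIcc a b, u' s ≤ 0)
    (hu_mem : ∀ s ∈ Set.uIcc a b, u s ∈ Set.Icc 0 1)
    (hf : IntervalIntegrable f volume a b) (hfc : ContinuousOn f (Set.Ioo a b))
    (hM : ∀ t ∈ Set.Icc a b, |∫ s in a..t, f s| ≤ M) :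
    |∫ s in a..b, u s * f s| ≤ 2 * M := by
  obtain ⟨ha0, ha1⟩ := hu_mem a Set.left_mem_uIcc
  obtain ⟨hb0, hb1⟩ := hu_mem b Set.right_mem_uIcc
  have hM0 : 0 ≤ M := (abs_nonneg _).trans (hM a ⟨le_rfl, hab⟩)
  have hvar : |u b| + |u b - u a| ≤ 2 := by
    have : |u b - u a| ≤ 1 := abs_le.2 ⟨by linarith, by linarith⟩
    rw [abs_of_nonneg hb0]
    linarith
  calc |∫ s in a..b, u s * f s| ≤ M * (|u b| + |u b - u a|) :=
        abs_integral_mul_le_of_deriv_sign hab hu hu' hsign hf hfc hM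
    _ ≤ M * 2 := mul_le_mul_of_nonneg_left hvar hM0
    _ = 2 * M := mul_comm M 2

end MonotoneWeight

lemma abs_integral_sinc_le_of_one_le {a b : ℝ} (ha : 1 ≤ a) (hab : a ≤ b) :
    |∫ s in a..b, Real.sinc s| ≤ 2 := by
  have hpos : ∀ s ∈ Set.uIcc a b, 0 < s := by
    rw [Set.uIcc_of_le hab]
    exact fun s hs => zero_lt_one.trans_le (ha.trans hs.1)
  have hbound := abs_integral_mul_le_of_deriv_sign (f := Real.sin) (M := 2) hab
    (fun s hs => hasDerivAt_inv (hpos s hs).ne')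
    (ContinuousOn.neg (ContinuousOn.inv₀ (by fun_prop) fun s hs => pow_ne_zero 2 (hpos s hs).ne'))
    (Or.inr fun s _ => neg_nonpos.2 (by positivity)) (Real.continuous_sin.intervalIntegrable _ _)
    Real.continuous_sin.continuousOn fun t _ => by
      rw [integral_sin, abs_le]
      constructor <;>
        linarith [Real.cos_le_one a, Real.neg_one_le_cos a, Real.cos_le_one t,
          Real.neg_one_le_cos t]
  have hinv : |b⁻¹| + |b⁻¹ - a⁻¹| ≤ 1 := by
    have hba : b⁻¹ ≤ a⁻¹ := inv_anti₀ (by linarith) hab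
    rw [abs_of_pos (inv_pos.2 (by linarith)), abs_of_nonpos (sub_nonpos.2 hba)]
    linarith [inv_le_one_of_one_le₀ ha]
  rw [intervalIntegral.integral_congr (g := fun s => s⁻¹ * Real.sin s) fun s hs => by
    simp only [Real.sinc_of_ne_zero (hpos s hs).ne', div_eq_inv_mul]]
  linarith

lemma abs_integral_sinc_le {a b : ℝ} (ha : 0 ≤ a) (hab : a ≤ b) :
    |∫ s in a..b, Real.sinc s| ≤ 3 := by
  have hlength : ∀ c, a ≤ c → |∫ s in a..c, Real.sinc s| ≤ c - a := fun c hac => by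
    have := intervalIntegral.norm_integral_le_of_norm_le_const (a := a) (b := c)
      (f := Real.sinc) fun s _ => Real.abs_sinc_le_one s
    rwa [one_mul, abs_of_nonneg (sub_nonneg.2 hac)] at this
  rcases le_total b 1 with hb | hb
  · linarith [hlength b hab]
  have hsplit := intervalIntegral.integral_add_adjacent_intervals
    (Real.continuous_sinc.intervalIntegrable a (max a 1) (μ := volume))
    (Real.continuous_sinc.intervalIntegrable (max a 1) b)
  have hnear : max a 1 - a ≤ 1 := by
    rw [sub_le_iff_le_add]
    exact max_le (by linarith) (by linarith)
  rw [← hsplit]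
  linarith [abs_add_le (∫ s in a..max a 1, Real.sinc s) (∫ s in max a 1..b, Real.sinc s),
    hlength _ (le_max_left a 1),
    abs_integral_sinc_le_of_one_le (le_max_right a 1) (max_le hab hb)]

lemma abs_integral_mul_sinc_le (A : ℝ) {a b : ℝ} (ha : 0 ≤ a) (hab : a ≤ b) :
    |∫ s in a..b, A * Real.sinc (s * A)| ≤ 3 := by
  have heven : ∀ s, Real.sinc (s * A) = Real.sinc (s * |A|) := fun s => by
    rcases abs_choice A with h | h <;> simp [h, Real.sinc_neg]
  simp only [heven, intervalIntegral.integral_const_mul]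
  rw [abs_mul, ← abs_abs A, ← abs_mul, abs_abs, intervalIntegral.mul_integral_comp_mul_right]
  exact abs_integral_sinc_le (by positivity) (mul_le_mul_of_nonneg_right hab (abs_nonneg A))

/-! ### The oscillatory kernel -/

/-- The real part of `e^{isA} / (δ + is)`, the kernel of a simple pole at signed distance `δ` from
the line of integration. At `δ = s = 0` its value is `0`. -/
def oscKernel (δ A s : ℝ) : ℝ := (δ * Real.cos (s * A) + s * Real.sin (s * A)) / (δ ^ 2 + s ^ 2)

lemma exp_div_re_eq_oscKernel (δ A s : ℝ) :
    (Complex.exp ((s * A : ℝ) * Complex.I) / (δ + Complex.I * s)).re = oscKernel δ A s := by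
  rw [Complex.div_re, Complex.exp_ofReal_mul_I_re, Complex.exp_ofReal_mul_I_im, oscKernel]
  simp only [Complex.normSq_apply, Complex.add_re, Complex.add_im, Complex.ofReal_re,
    Complex.ofReal_im, Complex.mul_re, Complex.mul_im, Complex.I_re, Complex.I_im, zero_mul,
    mul_zero, one_mul, sub_self, add_zero, zero_add]
  ring

lemma oscKernel_neg_neg (δ A s : ℝ) : oscKernel (-δ) (-A) s = -oscKernel δ A s := by
  unfold oscKernel
  rw [mul_neg, Real.cos_neg, Real.sin_neg, neg_sq, ← neg_div]
  congr 1
  ring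

@[fun_prop]
lemma measurable_oscKernel (δ A : ℝ) : Measurable (oscKernel δ A) := by
  unfold oscKernel
  fun_prop

lemma continuousOn_oscKernel (δ A : ℝ) : ContinuousOn (oscKernel δ A) (Set.Ioi 0) := by
  unfold oscKernel
  apply ContinuousOn.div (by fun_prop) (by fun_prop)
  intro s hs
  have : (0 : ℝ) < s := hs
  positivity

lemma abs_oscKernel_le_inv_norm (δ A s : ℝ) : |oscKernel δ A s| ≤ 1 / ‖δ + Complex.I * s‖ := by
  rw [← exp_div_re_eq_oscKernel]
  refine (Complex.abs_re_le_norm _).trans_eq ?_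
  rw [norm_div, Complex.norm_exp_ofReal_mul_I]

lemma abs_oscKernel_le_left {δ : ℝ} (A s : ℝ) (hδ : δ ≠ 0) : |oscKernel δ A s| ≤ 1 / |δ| := by
  refine (abs_oscKernel_le_inv_norm δ A s).trans
    (one_div_le_one_div_of_le (abs_pos.2 hδ) ?_)
  simpa using Complex.abs_re_le_norm (δ + Complex.I * s)

lemma abs_oscKernel_le_right (δ A : ℝ) {s : ℝ} (hs : 0 < s) : |oscKernel δ A s| ≤ 1 / s := by
  refine (abs_oscKernel_le_inv_norm δ A s).trans (one_div_le_one_div_of_le hs ?_)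
  simpa [abs_of_pos hs] using Complex.abs_im_le_norm (δ + Complex.I * s)

lemma oscKernel_eq_cos_add_sinc (δ A s : ℝ) :
    oscKernel δ A s = Real.cos (s * A) * (δ / (δ ^ 2 + s ^ 2)) +
      s ^ 2 / (δ ^ 2 + s ^ 2) * (A * Real.sinc (s * A)) := by
  have hsin : s * (A * Real.sinc (s * A)) = Real.sin (s * A) := by
    rcases eq_or_ne (s * A) 0 with h | h
    · rw [h, ← mul_assoc, h, zero_mul, Real.sin_zero]
    · rw [Real.sinc_of_ne_zero h, ← mul_assoc, mul_div_cancel₀ _ h]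
  rw [oscKernel, ← hsin]
  ring

lemma abs_cos_mul_cauchy_le (δ A s : ℝ) :
    |Real.cos (s * A) * (δ / (δ ^ 2 + s ^ 2))| ≤ |δ| / (|δ| ^ 2 + s ^ 2) := by
  rw [sq_abs, abs_mul, abs_div, abs_of_nonneg (by positivity : 0 ≤ δ ^ 2 + s ^ 2)]
  exact mul_le_of_le_one_left (by positivity) (Real.abs_cos_le_one _)

lemma cauchy_le_one_div_abs (δ s : ℝ) : |δ| / (|δ| ^ 2 + s ^ 2) ≤ 1 / |δ| := by
  rcases eq_or_ne δ 0 with rfl | h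
  · simp
  have : 0 < |δ| := abs_pos.2 h
  rw [div_le_div_iff₀ (by positivity) this]
  nlinarith [sq_nonneg s]

lemma sq_div_sq_add_sq_mem_Icc (δ s : ℝ) : s ^ 2 / (δ ^ 2 + s ^ 2) ∈ Set.Icc 0 1 :=
  ⟨by positivity, div_le_one_of_le₀ (by linarith [sq_nonneg δ]) (by positivity)⟩

/-- For `δ = 0` the first term is `0` by the convention `1 / 0 = 0`, and the bound still holds. -/
lemma abs_oscKernel_le (δ A s : ℝ) : |oscKernel δ A s| ≤ 1 / |δ| + |A| := by
  obtain ⟨hw0, hw1⟩ := sq_div_sq_add_sq_mem_Icc δ s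
  have hsinc : |s ^ 2 / (δ ^ 2 + s ^ 2) * (A * Real.sinc (s * A))| ≤ |A| := by
    rw [abs_mul, abs_mul, abs_of_nonneg hw0]
    exact (mul_le_of_le_one_left (by positivity) hw1).trans
      (mul_le_of_le_one_right (abs_nonneg A) (Real.abs_sinc_le_one _))
  rw [oscKernel_eq_cos_add_sinc]
  exact (abs_add_le _ _).trans (add_le_add
    ((abs_cos_mul_cauchy_le δ A s).trans (cauchy_le_one_div_abs δ s)) hsinc)

lemma intervalIntegrable_of_measurable_of_abs_le {f : ℝ → ℝ} (hf : Measurable f) {C : ℝ}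
    (h : ∀ s, |f s| ≤ C) (a b : ℝ) : IntervalIntegrable f volume a b := by
  rw [intervalIntegrable_iff]
  exact Measure.integrableOn_of_bounded (M := C) (by simp [Set.uIoc]) hf.aestronglyMeasurable
    (Eventually.of_forall h)

lemma intervalIntegrable_oscKernel (δ A a b : ℝ) :
    IntervalIntegrable (oscKernel δ A) volume a b :=
  intervalIntegrable_of_measurable_of_abs_le (measurable_oscKernel δ A) (abs_oscKernel_le δ A) a b

lemma intervalIntegrable_cauchy (δ a b : ℝ) :
    IntervalIntegrable (fun s => δ / (δ ^ 2 + s ^ 2)) volume a b := by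
  have hkernel : oscKernel δ 0 = fun s => δ / (δ ^ 2 + s ^ 2) :=
    funext fun s => by simp [oscKernel]
  exact hkernel ▸ intervalIntegrable_oscKernel δ 0 a b

/-- For `δ = 0` both sides vanish because of the convention `x / 0 = 0`. -/
lemma integral_cauchy (δ a b : ℝ) :
    ∫ s in a..b, δ / (δ ^ 2 + s ^ 2) = Real.arctan (b / δ) - Real.arctan (a / δ) := by
  rcases eq_or_ne δ 0 with rfl | h
  · simp
  refine intervalIntegral.integral_eq_sub_of_hasDerivAt (f := fun s => Real.arctan (s / δ))
    (fun s _ => ?_) (intervalIntegrable_cauchy δ a b)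
  refine (((hasDerivAt_id s).div_const δ).arctan).congr_deriv ?_
  simp only [id]
  field_simp

lemma abs_integral_cos_mul_cauchy_le (δ A : ℝ) {a b : ℝ} (ha : 0 ≤ a) (hab : a ≤ b) :
    |∫ s in a..b, Real.cos (s * A) * (δ / (δ ^ 2 + s ^ 2))| ≤ Real.pi / 2 := calc
  |∫ s in a..b, Real.cos (s * A) * (δ / (δ ^ 2 + s ^ 2))|
      ≤ ∫ s in a..b, |δ| / (|δ| ^ 2 + s ^ 2) := by
    rw [← Real.norm_eq_abs]
    exact intervalIntegral.norm_integral_le_of_norm_le hab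
      (Eventually.of_forall fun s _ => abs_cos_mul_cauchy_le δ A s)
      (intervalIntegrable_cauchy |δ| a b)
  _ = Real.arctan (b / |δ|) - Real.arctan (a / |δ|) := integral_cauchy |δ| a b
  _ ≤ Real.pi / 2 := by
    linarith [Real.arctan_lt_pi_div_two (b / |δ|),
      Real.arctan_nonneg.2 (div_nonneg ha (abs_nonneg δ))]

lemma abs_integral_sq_div_mul_sinc_le (δ A : ℝ) {a b : ℝ} (ha : 0 ≤ a) (hab : a ≤ b) :
    |∫ s in a..b, s ^ 2 / (δ ^ 2 + s ^ 2) * (A * Real.sinc (s * A))| ≤ 6 := by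
  rcases eq_or_ne δ 0 with rfl | hδ
  · have hcongr : ∫ s in a..b, s ^ 2 / ((0 : ℝ) ^ 2 + s ^ 2) * (A * Real.sinc (s * A)) =
        ∫ s in a..b, A * Real.sinc (s * A) := by
      refine intervalIntegral.integral_congr_ae ?_
      filter_upwards [Measure.ae_ne volume (0 : ℝ)] with s hs _
      rw [zero_pow two_ne_zero, zero_add, div_self (pow_ne_zero 2 hs), one_mul]
    rw [hcongr]
    linarith [abs_integral_mul_sinc_le A ha hab]
  have hden : ∀ s : ℝ, δ ^ 2 + s ^ 2 ≠ 0 := fun s => by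
    have := sq_nonneg s
    positivity
  have hcont : Continuous fun s => A * Real.sinc (s * A) := by
    have := Real.continuous_sinc
    fun_prop
  have hderiv : ∀ s, HasDerivAt (fun s : ℝ => s ^ 2 / (δ ^ 2 + s ^ 2))
      (2 * δ ^ 2 * s / (δ ^ 2 + s ^ 2) ^ 2) s := fun s => by
    refine ((hasDerivAt_pow 2 s).div ((hasDerivAt_pow 2 s).const_add (δ ^ 2))
      (hden s)).congr_deriv ?_
    ring
  have := abs_integral_mul_le_two_mul_of_deriv_sign hab (fun s _ => hderiv s)
    (ContinuousOn.div (by fun_prop) (by fun_prop) fun s _ => pow_ne_zero 2 (hden s))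
    (Or.inl fun s hs => by
      rw [Set.uIcc_of_le hab] at hs
      have := ha.trans hs.1
      positivity)
    (fun s _ => sq_div_sq_add_sq_mem_Icc δ s) (hcont.intervalIntegrable a b) hcont.continuousOn
    fun t ht => abs_integral_mul_sinc_le A ha ht.1
  linarith

lemma abs_integral_oscKernel_le (δ A : ℝ) {a b : ℝ} (ha : 0 ≤ a) (hab : a ≤ b) :
    |∫ s in a..b, oscKernel δ A s| ≤ 8 := by
  have hcos : IntervalIntegrable (fun s => Real.cos (s * A) * (δ / (δ ^ 2 + s ^ 2))) volume a b :=
    (intervalIntegrable_cauchy δ a b).continuousOn_mul (by fun_prop)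
  have hsinc := ((intervalIntegrable_oscKernel δ A a b).sub hcos).congr
    (g := fun s => s ^ 2 / (δ ^ 2 + s ^ 2) * (A * Real.sinc (s * A)))
    (fun s _ => by simp only [oscKernel_eq_cos_add_sinc, add_sub_cancel_left])
  simp only [oscKernel_eq_cos_add_sinc]
  rw [intervalIntegral.integral_add hcos hsinc]
  linarith [abs_add_le (∫ s in a..b, Real.cos (s * A) * (δ / (δ ^ 2 + s ^ 2)))
      (∫ s in a..b, s ^ 2 / (δ ^ 2 + s ^ 2) * (A * Real.sinc (s * A))),
    abs_integral_cos_mul_cauchy_le δ A ha hab, abs_integral_sq_div_mul_sinc_le δ A ha hab,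
    Real.pi_le_four]

lemma abs_integral_gaussian_mul_oscKernel_le (δ A y p : ℝ) {a b : ℝ} (ha : 0 ≤ a) (hab : a ≤ b)
    (hp : ∀ s ∈ Set.Icc a b, 0 ≤ (s ^ 2 - p) * y) :
    |∫ s in a..b, Real.exp (-((s ^ 2 - p) * y)) * oscKernel δ A s| ≤ 16 := by
  rw [← Set.uIcc_of_le hab] at hp
  have hnonneg : ∀ s ∈ Set.uIcc a b, 0 ≤ s := by
    rw [Set.uIcc_of_le hab]
    exact fun s hs => ha.trans hs.1
  have hderiv : ∀ s, HasDerivAt (fun s : ℝ => Real.exp (-((s ^ 2 - p) * y)))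
      (Real.exp (-((s ^ 2 - p) * y)) * -(2 * s * y)) s := fun s => by
    simpa using (((hasDerivAt_pow 2 s).sub_const p).mul_const y).neg.exp
  have hsign : (∀ s ∈ Set.uIcc a b, 0 ≤ Real.exp (-((s ^ 2 - p) * y)) * -(2 * s * y)) ∨
      ∀ s ∈ Set.uIcc a b, Real.exp (-((s ^ 2 - p) * y)) * -(2 * s * y) ≤ 0 := by
    rcases le_total y 0 with hy | hy
    · exact Or.inl fun s hs => mul_nonneg (Real.exp_nonneg _)
        (neg_nonneg.2 (mul_nonpos_of_nonneg_of_nonpos (by linarith [hnonneg s hs]) hy))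
    · exact Or.inr fun s hs => mul_nonpos_of_nonneg_of_nonpos (Real.exp_nonneg _)
        (neg_nonpos.2 (mul_nonneg (by linarith [hnonneg s hs]) hy))
  have := abs_integral_mul_le_two_mul_of_deriv_sign hab (fun s _ => hderiv s) (by fun_prop) hsign
    (fun s hs => ⟨Real.exp_nonneg _, Real.exp_le_one_iff.2 (neg_nonpos.2 (hp s hs))⟩)
    (intervalIntegrable_oscKernel δ A a b)
    ((continuousOn_oscKernel δ A).mono fun s hs => ha.trans_lt hs.1)
    fun t ht => abs_integral_oscKernel_le δ A ha ht.1
  linarith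

/-! ### Gaussian integrals of the kernel -/

lemma integrable_gaussian {y : ℝ} (hy : 0 < y) :
    Integrable fun s : ℝ => Real.exp (-(s ^ 2 * y)) := by
  simpa only [neg_mul, mul_comm] using integrable_exp_neg_mul_sq hy

lemma integrable_gaussian_mul {y : ℝ} (hy : 0 < y) {f : ℝ → ℝ} (hf : Measurable f) {C : ℝ}
    (h : ∀ s, |f s| ≤ C) : Integrable fun s : ℝ => Real.exp (-(s ^ 2 * y)) * f s := by
  simp only [mul_comm (Real.exp _)]
  exact (integrable_gaussian hy).bdd_mul (c := C) hf.aestronglyMeasurable (Eventually.of_forall h)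

lemma integral_gaussian_mul_cos {y : ℝ} (hy : 0 < y) (A : ℝ) :
    ∫ s : ℝ, Real.exp (-(s ^ 2 * y)) * Real.cos (s * A) =
      Real.sqrt (Real.pi / y) * Real.exp (-(A ^ 2 / (4 * y))) := by
  have hphase : ∀ s : ℝ, Complex.I * A * s = ((s * A : ℝ) : ℂ) * Complex.I := fun s => by
    push_cast; ring
  have hre : ∀ s : ℝ, RCLike.re (Complex.exp (Complex.I * A * s) * Complex.exp (-y * s ^ 2)) =
      Real.exp (-(s ^ 2 * y)) * Real.cos (s * A) := fun s => by
    have hgauss : Complex.exp (-y * s ^ 2) = (Real.exp (-(s ^ 2 * y)) : ℝ) := by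
      push_cast; ring_nf
    rw [hgauss, hphase, RCLike.re_to_complex, Complex.re_mul_ofReal, Complex.exp_ofReal_mul_I_re,
      mul_comm]
  have hint : Integrable fun s : ℝ =>
      Complex.exp (Complex.I * A * s) * Complex.exp (-y * s ^ 2) := by
    refine Integrable.bdd_mul (c := 1) (integrable_cexp_neg_mul_sq (b := y) (by simpa using hy))
      (by fun_prop) (Eventually.of_forall fun s => ?_)
    rw [hphase, Complex.norm_exp_ofReal_mul_I]
  have hval : ((Real.pi / y : ℂ) ^ (1 / 2 : ℂ) * Complex.exp (-(A : ℂ) ^ 2 / (4 * y))) =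
      ((Real.sqrt (Real.pi / y) * Real.exp (-(A ^ 2 / (4 * y))) : ℝ) : ℂ) := by
    rw [Real.sqrt_eq_rpow]
    push_cast
    rw [Complex.ofReal_cpow (by positivity), neg_div]
    push_cast
    rfl
  rw [← Complex.ofReal_re (Real.sqrt (Real.pi / y) * _), ← hval,
    ← fourierIntegral_gaussian (by simpa using hy), ← RCLike.re_to_complex, ← integral_re hint]
  simp only [hre]

lemma integral_Ioi_gaussian_mul_cos {y : ℝ} (hy : 0 < y) (A : ℝ) :
    ∫ s in Set.Ioi (0 : ℝ), Real.exp (-(s ^ 2 * y)) * Real.cos (s * A) =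
      Real.sqrt (Real.pi / y) / 2 * Real.exp (-(A ^ 2 / (4 * y))) := by
  have heven : ∀ s : ℝ, Real.exp (-(|s| ^ 2 * y)) * Real.cos (|s| * A) =
      Real.exp (-(s ^ 2 * y)) * Real.cos (s * A) := fun s => by
    rcases abs_choice s with h | h <;> simp [h]
  have hhalf := integral_comp_abs (f := fun s => Real.exp (-(s ^ 2 * y)) * Real.cos (s * A))
  simp only [heven, integral_gaussian_mul_cos hy] at hhalf
  linarith

/-- The error function scaled to have the limits `±π` at `±∞` and the variance `2 y`. -/
def erfPi (y Z : ℝ) : ℝ :=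
  Real.sqrt (Real.pi / y) * ∫ t in (0 : ℝ)..Z, Real.exp (-(t ^ 2 / (4 * y)))

lemma hasDerivAt_erfPi (y Z : ℝ) :
    HasDerivAt (erfPi y) (Real.sqrt (Real.pi / y) * Real.exp (-(Z ^ 2 / (4 * y)))) Z := by
  have hc : Continuous fun t : ℝ => Real.exp (-(t ^ 2 / (4 * y))) := by fun_prop
  exact (intervalIntegral.integral_hasDerivAt_right (hc.intervalIntegrable _ _)
    hc.stronglyMeasurable.stronglyMeasurableAtFilter hc.continuousAt).const_mul _

lemma erfPi_zero (y : ℝ) : erfPi y 0 = 0 := by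
  simp [erfPi]

lemma erfPi_neg (y Z : ℝ) : erfPi y (-Z) = -erfPi y Z := by
  have hreflect := intervalIntegral.integral_comp_neg (a := 0) (b := Z)
    fun t : ℝ => Real.exp (-(t ^ 2 / (4 * y)))
  simp only [neg_sq, neg_zero] at hreflect
  rw [erfPi, erfPi, hreflect, intervalIntegral.integral_symm, mul_neg]

lemma monotone_erfPi (y : ℝ) : Monotone (erfPi y) := by
  refine monotone_of_hasDerivAt_nonneg (hasDerivAt_erfPi y) fun Z => ?_
  simp only [Pi.zero_apply]
  positivity

lemma tendsto_erfPi_atTop {y : ℝ} (hy : 0 < y) : Tendsto (erfPi y) atTop (𝓝 Real.pi) := by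
  have hrw : ∀ t : ℝ, -(t ^ 2 / (4 * y)) = -(1 / (4 * y)) * t ^ 2 := fun t => by ring
  have hint : IntegrableOn (fun t : ℝ => Real.exp (-(t ^ 2 / (4 * y)))) (Set.Ioi 0) := by
    simp only [hrw]
    exact (integrable_exp_neg_mul_sq (by positivity)).integrableOn
  have hlim := (intervalIntegral_tendsto_integral_Ioi 0 hint tendsto_id).const_mul
    (Real.sqrt (Real.pi / y))
  have hnorm : Real.sqrt (Real.pi / y) * ∫ t in Set.Ioi (0 : ℝ), Real.exp (-(t ^ 2 / (4 * y))) =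
      Real.pi := by
    simp only [hrw]
    rw [integral_gaussian_Ioi, ← mul_div_assoc, ← Real.sqrt_mul (by positivity),
      show Real.pi / y * (Real.pi / (1 / (4 * y))) = (2 * Real.pi) ^ 2 by field_simp; ring,
      Real.sqrt_sq (by positivity)]
    ring
  rwa [hnorm] at hlim

lemma tendsto_erfPi_atBot {y : ℝ} (hy : 0 < y) : Tendsto (erfPi y) atBot (𝓝 (-Real.pi)) :=
  ((tendsto_erfPi_atTop hy).comp tendsto_neg_atBot_atTop).neg.congr fun Z => by simp [erfPi_neg]

lemma abs_erfPi_le {y : ℝ} (hy : 0 < y) (Z : ℝ) : |erfPi y Z| ≤ Real.pi :=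
  abs_le.2 ⟨(monotone_erfPi y).le_of_tendsto (tendsto_erfPi_atBot hy) Z,
    (monotone_erfPi y).ge_of_tendsto (tendsto_erfPi_atTop hy) Z⟩

/-- The Gaussian integral of the kernel of a pole at distance `δ`. With this exponential factor its
derivative in `Z` does not depend on `δ`. -/
def poleIntegral (y δ Z : ℝ) : ℝ :=
  Real.exp (δ * Z + δ ^ 2 * y) *
    ∫ s in Set.Ioi (0 : ℝ), Real.exp (-(s ^ 2 * y)) * oscKernel δ (Z + 2 * δ * y) s

lemma poleIntegral_neg_neg (y δ Z : ℝ) : poleIntegral y (-δ) (-Z) = -poleIntegral y δ Z := by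
  unfold poleIntegral
  rw [show -Z + 2 * -δ * y = -(Z + 2 * δ * y) by ring, neg_mul_neg, neg_sq, ← mul_neg,
    ← integral_neg]
  simp only [oscKernel_neg_neg, mul_neg]

lemma hasDerivAt_exp_mul_oscKernel (δ y Z : ℝ) {s : ℝ} (hs : s ≠ 0) :
    HasDerivAt (fun Z => Real.exp (δ * Z + δ ^ 2 * y) * oscKernel δ (Z + 2 * δ * y) s)
      (Real.exp (δ * Z + δ ^ 2 * y) * Real.cos (s * (Z + 2 * δ * y))) Z := by
  have hA : HasDerivAt (fun Z : ℝ => s * (Z + 2 * δ * y)) s Z := by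
    simpa using ((hasDerivAt_id Z).add_const (2 * δ * y)).const_mul s
  have hE : HasDerivAt (fun Z : ℝ => Real.exp (δ * Z + δ ^ 2 * y))
      (Real.exp (δ * Z + δ ^ 2 * y) * δ) Z := by
    simpa using (((hasDerivAt_id Z).const_mul δ).add_const (δ ^ 2 * y)).exp
  refine (hE.mul (((hA.cos.const_mul δ).add (hA.sin.const_mul s)).div_const
    (δ ^ 2 + s ^ 2))).congr_deriv ?_
  simp only [Pi.add_apply]
  field_simp
  ring

lemma abs_exp_mul_cos_le_of_mem_ball (c δ t : ℝ) {W Z : ℝ} (hW : W ∈ Metric.ball Z 1) :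
    |Real.exp (δ * W + c) * Real.cos t| ≤ Real.exp (|δ| * (|Z| + 1) + c) := by
  have hW' : |W| ≤ |Z| + 1 := by
    rw [Metric.mem_ball, Real.dist_eq] at hW
    linarith [abs_sub_abs_le_abs_sub W Z]
  have hexp : δ * W ≤ |δ| * (|Z| + 1) := calc
    δ * W ≤ |δ| * |W| := (le_abs_self _).trans_eq (abs_mul δ W)
    _ ≤ |δ| * (|Z| + 1) := mul_le_mul_of_nonneg_left hW' (abs_nonneg δ)
  rw [abs_mul, Real.abs_exp]
  exact (mul_le_of_le_one_right (Real.exp_nonneg _) (Real.abs_cos_le_one _)).trans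
    (Real.exp_le_exp.2 (by linarith))

lemma hasDerivAt_integral_gaussian_mul_oscKernel {y : ℝ} (hy : 0 < y) (δ Z : ℝ) :
    HasDerivAt (fun Z => ∫ s in Set.Ioi (0 : ℝ), Real.exp (-(s ^ 2 * y)) *
        (Real.exp (δ * Z + δ ^ 2 * y) * oscKernel δ (Z + 2 * δ * y) s))
      (∫ s in Set.Ioi (0 : ℝ), Real.exp (-(s ^ 2 * y)) *
        (Real.exp (δ * Z + δ ^ 2 * y) * Real.cos (s * (Z + 2 * δ * y)))) Z := by
  refine (hasDerivAt_integral_of_dominated_loc_of_deriv_le (𝕜 := ℝ)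
    (F := fun Z s => Real.exp (-(s ^ 2 * y)) *
      (Real.exp (δ * Z + δ ^ 2 * y) * oscKernel δ (Z + 2 * δ * y) s))
    (F' := fun Z s => Real.exp (-(s ^ 2 * y)) *
      (Real.exp (δ * Z + δ ^ 2 * y) * Real.cos (s * (Z + 2 * δ * y))))
    (bound := fun s => Real.exp (-(s ^ 2 * y)) * Real.exp (|δ| * (|Z| + 1) + δ ^ 2 * y))
    (Metric.ball_mem_nhds Z one_pos) ?_ ?_ ?_ ?_ ?_ ?_).2
  · exact Eventually.of_forall fun Z => Measurable.aestronglyMeasurable (by fun_prop)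
  · refine (integrable_gaussian_mul hy (by fun_prop)
      (C := Real.exp (δ * Z + δ ^ 2 * y) * (1 / |δ| + |Z + 2 * δ * y|)) fun s => ?_).integrableOn
    rw [abs_mul, Real.abs_exp]
    exact mul_le_mul_of_nonneg_left (abs_oscKernel_le _ _ s) (Real.exp_nonneg _)
  · exact Measurable.aestronglyMeasurable (by fun_prop)
  · refine Eventually.of_forall fun s W hW => ?_
    rw [Real.norm_eq_abs, abs_mul, Real.abs_exp]
    exact mul_le_mul_of_nonneg_left (abs_exp_mul_cos_le_of_mem_ball _ δ _ hW) (Real.exp_nonneg _)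
  · exact (integrable_gaussian hy).integrableOn.mul_const _
  · refine (ae_restrict_iff' measurableSet_Ioi).2 (Eventually.of_forall fun s hs W _ => ?_)
    exact (hasDerivAt_exp_mul_oscKernel δ y W (ne_of_gt hs)).const_mul _

lemma hasDerivAt_poleIntegral {y : ℝ} (hy : 0 < y) (δ Z : ℝ) :
    HasDerivAt (poleIntegral y δ)
      (1 / 2 * (Real.sqrt (Real.pi / y) * Real.exp (-(Z ^ 2 / (4 * y))))) Z := by
  have hcomplete : Real.exp (-(Z ^ 2 / (4 * y))) = Real.exp (δ * Z + δ ^ 2 * y) *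
      Real.exp (-((Z + 2 * δ * y) ^ 2 / (4 * y))) := by
    rw [← Real.exp_add]
    congr 1
    field_simp
    ring
  have hderiv := hasDerivAt_integral_gaussian_mul_oscKernel hy δ Z
  simp only [mul_left_comm (Real.exp (-(_ ^ 2 * y))), integral_const_mul,
    integral_Ioi_gaussian_mul_cos hy] at hderiv
  refine hderiv.congr_deriv ?_
  rw [hcomplete]
  ring

lemma poleIntegral_eq_add_erfPi {y : ℝ} (hy : 0 < y) (δ Z : ℝ) :
    poleIntegral y δ Z = poleIntegral y δ 0 + erfPi y Z / 2 := by
  have hderiv : ∀ Z, HasDerivAt (fun Z => poleIntegral y δ Z - 1 / 2 * erfPi y Z) 0 Z := fun Z =>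
    ((hasDerivAt_poleIntegral hy δ Z).sub ((hasDerivAt_erfPi y Z).const_mul (1 / 2))).congr_deriv
      (sub_self _)
  have hconst := is_const_of_deriv_eq_zero (fun Z => (hderiv Z).differentiableAt)
    (fun Z => (hderiv Z).deriv) Z 0
  rw [erfPi_zero] at hconst
  linarith

lemma abs_poleIntegral_le {y δ : ℝ} (hy : 0 < y) (hδ : δ ≠ 0) (Z : ℝ) :
    |poleIntegral y δ Z| ≤
      Real.exp (δ * Z + δ ^ 2 * y) * (1 / |δ| * (Real.sqrt (Real.pi / y) / 2)) := by
  have hgauss : ∫ s in Set.Ioi (0 : ℝ), Real.exp (-(s ^ 2 * y)) = Real.sqrt (Real.pi / y) / 2 := by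
    simpa only [neg_mul, mul_comm] using integral_gaussian_Ioi y
  rw [poleIntegral, abs_mul, Real.abs_exp, ← hgauss, ← integral_const_mul]
  refine mul_le_mul_of_nonneg_left ?_ (Real.exp_nonneg _)
  rw [← Real.norm_eq_abs]
  refine norm_integral_le_of_norm_le ((integrable_gaussian hy).integrableOn.const_mul _)
    (Eventually.of_forall fun s => ?_)
  rw [Real.norm_eq_abs, abs_mul, Real.abs_exp, mul_comm]
  exact mul_le_mul_of_nonneg_right (abs_oscKernel_le_left _ _ hδ) (Real.exp_nonneg _)

lemma tendsto_poleIntegral_atBot {y δ : ℝ} (hy : 0 < y) (hδ : 0 < δ) :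
    Tendsto (poleIntegral y δ) atBot (𝓝 0) := by
  have hexp : Tendsto (fun Z => Real.exp (δ * Z + δ ^ 2 * y)) atBot (𝓝 0) :=
    Real.tendsto_exp_atBot.comp (tendsto_atBot_add_const_right _ _ (tendsto_id.const_mul_atBot hδ))
  refine squeeze_zero_norm (abs_poleIntegral_le hy hδ.ne') ?_
  simpa using hexp.mul_const (1 / |δ| * (Real.sqrt (Real.pi / y) / 2))

lemma poleIntegral_zero_of_pos {y δ : ℝ} (hy : 0 < y) (hδ : 0 < δ) :
    poleIntegral y δ 0 = Real.pi / 2 := by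
  have hlim : Tendsto (poleIntegral y δ) atBot (𝓝 (poleIntegral y δ 0 + -Real.pi / 2)) :=
    (((tendsto_erfPi_atBot hy).div_const 2).const_add _).congr fun Z =>
      (poleIntegral_eq_add_erfPi hy δ Z).symm
  linarith [tendsto_nhds_unique hlim (tendsto_poleIntegral_atBot hy hδ)]

lemma poleIntegral_eq {y : ℝ} (hy : 0 < y) (δ Z : ℝ) :
    poleIntegral y δ Z = (erfPi y Z + Real.pi * Real.sign δ) / 2 := by
  have hodd : poleIntegral y (-δ) 0 = -poleIntegral y δ 0 := by
    simpa using poleIntegral_neg_neg y δ 0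
  rw [poleIntegral_eq_add_erfPi hy]
  rcases lt_trichotomy δ 0 with hδ | rfl | hδ
  · rw [poleIntegral_zero_of_pos hy (neg_pos.2 hδ)] at hodd
    rw [Real.sign_of_neg hδ]
    linarith
  · rw [neg_zero] at hodd
    rw [Real.sign_zero]
    linarith
  · rw [poleIntegral_zero_of_pos hy hδ, Real.sign_of_pos hδ]
    ring

/-! ### The integrand on a vertical line -/

lemma heaviside_of_pos {t : ℝ} (h : 0 < t) : heaviside t = 1 := by
  simp [heaviside, h.not_gt, h.ne']

lemma heaviside_of_neg {t : ℝ} (h : t < 0) : heaviside t = 0 := by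
  simp [heaviside, h]

lemma heaviside_mem_Icc (t : ℝ) : heaviside t ∈ Set.Icc 0 1 := by
  unfold heaviside
  split_ifs <;> norm_num

lemma heaviside_eq_sign (t : ℝ) : heaviside t = (1 + Real.sign t) / 2 := by
  rcases lt_trichotomy t 0 with h | h | h
  · simp [heaviside_of_neg h, Real.sign_of_neg h]
  · simp [h, heaviside]
  · rw [heaviside_of_pos h, Real.sign_of_pos h]
    norm_num

@[fun_prop]
lemma measurable_heaviside : Measurable heaviside := by
  unfold heaviside
  exact Measurable.ite measurableSet_Iio measurable_const
    (Measurable.ite (measurableSet_singleton 0) measurable_const measurable_const)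

lemma heaviside_mul_gaussian_le_indicator {y : ℝ} (hy : y < 0) (q s : ℝ) :
    heaviside ((s ^ 2 - q ^ 2) * y) * Real.exp (-(s ^ 2 * y)) ≤
      (Set.Icc (-|q|) |q|).indicator (fun _ => Real.exp (-(q ^ 2 * y))) s := by
  by_cases hs : s ∈ Set.Icc (-|q|) |q|
  · have hsq : s ^ 2 ≤ q ^ 2 := sq_le_sq.2 (abs_le.2 hs)
    rw [Set.indicator_of_mem hs]
    exact (mul_le_of_le_one_left (Real.exp_nonneg _) (heaviside_mem_Icc _).2).trans
      (Real.exp_le_exp.2 (by nlinarith))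
  · have hsq : q ^ 2 < s ^ 2 := sq_lt_sq.2 (lt_of_not_ge fun h => hs (abs_le.1 h))
    rw [Set.indicator_of_notMem hs,
      heaviside_of_neg (mul_neg_of_pos_of_neg (sub_pos.2 hsq) hy), zero_mul]

/-- For `y < 0` the Heaviside factor confines the growing Gaussian to `|s| ≤ |q|`. -/
lemma integrable_heaviside_mul_gaussian {y : ℝ} (hy : y ≠ 0) (q : ℝ) :
    Integrable fun s : ℝ => heaviside ((s ^ 2 - q ^ 2) * y) * Real.exp (-(s ^ 2 * y)) := by
  rcases hy.lt_or_gt with hy | hy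
  · refine Integrable.mono' (g := (Set.Icc (-|q|) |q|).indicator fun _ => Real.exp (-(q ^ 2 * y)))
      ((integrable_indicator_iff measurableSet_Icc).2 (integrableOn_const (by simp)))
      (Measurable.aestronglyMeasurable (by fun_prop)) (Eventually.of_forall fun s => ?_)
    rw [Real.norm_eq_abs, abs_of_nonneg (mul_nonneg (heaviside_mem_Icc _).1 (Real.exp_nonneg _))]
    exact heaviside_mul_gaussian_le_indicator hy q s
  · simp only [mul_comm (heaviside _)]
    exact integrable_gaussian_mul hy (by fun_prop) fun s => by
      rw [abs_of_nonneg (heaviside_mem_Icc _).1]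
      exact (heaviside_mem_Icc _).2

/-- The real exponential factor `e^{k X + k² y}` of the eigenfunctions, at a real spectral
parameter. -/
def expPhase (k X y : ℝ) : ℝ := Real.exp (k * X + k ^ 2 * y)

lemma expPhase_pos (k X y : ℝ) : 0 < expPhase k X y := Real.exp_pos _

/-- The rational function with residues `c`, `c'` at the simple poles `k`, `k'` and the value `1`
at infinity; the product `χ(x, μ) ξ(x', μ)` has this form. -/
def twoPole (k k' c c' : ℝ) (μ : ℂ) : ℂ := 1 + c / (μ - k) + c' / (μ - k')

/-- The integrand of the Green function at `μ = r + i s`, as a function of the differences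
`X = x₁ - x₁'` and `y = x₂ - x₂'`. -/
def lineIntegrand (k k' c c' X y r s : ℝ) : ℂ :=
  Complex.exp ((r + Complex.I * s) * X + (r + Complex.I * s) ^ 2 * y) *
    twoPole k k' c c' (r + Complex.I * s)

/-- The real part of `lineIntegrand`, without the factor `e^{r X + r² y}`. The imaginary part is odd
in `s` and drops out of principal values. -/
def evenDensity (k k' c c' X y r s : ℝ) : ℝ :=
  Real.exp (-(s ^ 2 * y)) * (Real.cos (s * (X + 2 * r * y)) +
    c * oscKernel (r - k) (X + 2 * r * y) s + c' * oscKernel (r - k') (X + 2 * r * y) s)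

section LineIntegrand

variable (k k' c c' X y r : ℝ)

lemma exp_line_eq (s : ℝ) :
    Complex.exp ((r + Complex.I * s) * X + (r + Complex.I * s) ^ 2 * y) =
      ((expPhase r X y * Real.exp (-(s ^ 2 * y)) : ℝ) : ℂ) *
        Complex.exp ((s * (X + 2 * r * y) : ℝ) * Complex.I) := by
  unfold expPhase
  push_cast
  rw [← Complex.exp_add, ← Complex.exp_add]
  congr 1
  linear_combination (s : ℂ) ^ 2 * y * Complex.I_sq

lemma norm_exp_line (s : ℝ) :
    ‖Complex.exp ((r + Complex.I * s) * X + (r + Complex.I * s) ^ 2 * y)‖ =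
      expPhase r X y * Real.exp (-(s ^ 2 * y)) := by
  rw [exp_line_eq, norm_mul, Complex.norm_exp_ofReal_mul_I, mul_one, Complex.norm_real,
    Real.norm_of_nonneg (mul_nonneg (expPhase_pos r X y).le (Real.exp_nonneg _))]

lemma lineIntegrand_neg (s : ℝ) :
    lineIntegrand k k' c c' X y r (-s) = starRingEnd ℂ (lineIntegrand k k' c c' X y r s) := by
  simp [lineIntegrand, twoPole, ← Complex.exp_conj, Complex.conj_ofReal]

lemma lineIntegrand_re (s : ℝ) :
    (lineIntegrand k k' c c' X y r s).re = expPhase r X y * evenDensity k k' c c' X y r s := by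
  have hsub : ∀ p : ℝ, (r : ℂ) + Complex.I * s - p = (r - p : ℝ) + Complex.I * s := fun p => by
    push_cast; ring
  rw [lineIntegrand, twoPole, exp_line_eq, hsub, hsub, mul_assoc, Complex.re_ofReal_mul, mul_add,
    mul_add, mul_one, mul_div_left_comm, mul_div_left_comm _ (c' : ℂ), Complex.add_re,
    Complex.add_re, Complex.re_ofReal_mul, Complex.re_ofReal_mul, exp_div_re_eq_oscKernel,
    exp_div_re_eq_oscKernel, Complex.exp_ofReal_mul_I_re, evenDensity, mul_assoc]

lemma lineIntegrand_add_neg (s : ℝ) :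
    lineIntegrand k k' c c' X y r s + lineIntegrand k k' c c' X y r (-s) =
      ((2 * expPhase r X y * evenDensity k k' c c' X y r s : ℝ) : ℂ) := by
  rw [lineIntegrand_neg, Complex.add_conj, lineIntegrand_re, mul_assoc]

lemma norm_twoPole_le {s ε : ℝ} (hε : 0 < ε) (hs : ε ≤ |s|) :
    ‖twoPole k k' c c' (r + Complex.I * s)‖ ≤ 1 + |c| / ε + |c'| / ε := by
  have hpole : ∀ p d : ℝ, ‖(d : ℂ) / (r + Complex.I * s - p)‖ ≤ |d| / ε := fun p d => by
    rw [norm_div, Complex.norm_real, Real.norm_eq_abs]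
    refine div_le_div_of_nonneg_left (abs_nonneg d) hε (hs.trans ?_)
    simpa using Complex.abs_im_le_norm ((r : ℂ) + Complex.I * s - p)
  unfold twoPole
  refine (norm_add_le _ _).trans (add_le_add ((norm_add_le _ _).trans
    (add_le_add ?_ (hpole _ _))) (hpole _ _))
  simp

@[fun_prop]
lemma measurable_lineIntegrand : Measurable (lineIntegrand k k' c c' X y r) := by
  unfold lineIntegrand twoPole
  fun_prop

lemma abs_cos_add_oscKernel_add_oscKernel_le (A s : ℝ) :
    |Real.cos (s * A) + c * oscKernel (r - k) A s + c' * oscKernel (r - k') A s| ≤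
      1 + |c| * (1 / |r - k| + |A|) + |c'| * (1 / |r - k'| + |A|) := by
  refine (abs_add_le _ _).trans (add_le_add ((abs_add_le _ _).trans
    (add_le_add (Real.abs_cos_le_one _) ?_)) ?_) <;>
  · rw [abs_mul]
    exact mul_le_mul_of_nonneg_left (abs_oscKernel_le _ _ s) (abs_nonneg _)

lemma evenDensity_swap (s : ℝ) :
    evenDensity k k' c c' X y r s = evenDensity k' k c' c X y r s := by
  unfold evenDensity
  ring

lemma intervalIntegrable_evenDensity (a b : ℝ) :
    IntervalIntegrable (evenDensity k k' c c' X y r) volume a b :=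
  (intervalIntegrable_of_measurable_of_abs_le (by fun_prop)
    (abs_cos_add_oscKernel_add_oscKernel_le k k' c c' r (X + 2 * r * y)) a b).continuousOn_mul
    (by fun_prop)

variable {y}

lemma integrable_evenDensity (hy : 0 < y) : Integrable (evenDensity k k' c c' X y r) :=
  integrable_gaussian_mul hy (by fun_prop) (abs_cos_add_oscKernel_add_oscKernel_le _ _ _ _ _ _)

end LineIntegrand

/-! ### The principal value of the line integral -/

section PrincipalValue

variable {E : Type*} [NormedAddCommGroup E] [NormedSpace ℝ E] {F : ℝ → E}

lemma setIntegral_lt_abs {ε : ℝ} (hε : 0 < ε) (hF : IntegrableOn F {s | ε < |s|}) :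
    ∫ s in {s | ε < |s|}, F s = ∫ s in Set.Ioi ε, (F s + F (-s)) := by
  have hset : {s : ℝ | ε < |s|} = Set.Ioi ε ∪ Set.Iio (-ε) := by
    ext s
    simp only [Set.mem_ofPred_eq, Set.mem_union, Set.mem_Ioi, Set.mem_Iio, lt_abs, lt_neg]
  have hdisj : Disjoint (Set.Ioi ε) (Set.Iio (-ε)) :=
    Set.disjoint_left.2 fun s hs hs' => by
      rw [Set.mem_Ioi] at hs
      rw [Set.mem_Iio] at hs'
      linarith
  have hpos : IntegrableOn F (Set.Ioi ε) := hF.mono_set (hset ▸ Set.subset_union_left)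
  have hneg : IntegrableOn F (Set.Iio (-ε)) := hF.mono_set (hset ▸ Set.subset_union_right)
  have hreflect : IntegrableOn (fun s => F (-s)) (Set.Ioi ε) := by
    simpa using hneg.comp_neg
  rw [hset, setIntegral_union hdisj measurableSet_Iio hpos hneg, integral_add hpos hreflect,
    integral_comp_neg_Ioi, integral_Iic_eq_integral_Iio]

lemma tendsto_setIntegral_lt_abs (hF : ∀ ε > 0, IntegrableOn F {s | ε < |s|})
    (heven : IntegrableOn (fun s => F s + F (-s)) (Set.Ioi 0)) :
    Tendsto (fun ε => ∫ s in {s | ε < |s|}, F s) (𝓝[>] 0)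
      (𝓝 (∫ s in Set.Ioi 0, (F s + F (-s)))) := by
  have hcover : AECover (volume.restrict (Set.Ioi (0 : ℝ))) (𝓝[>] (0 : ℝ)) fun ε => Set.Ioi ε :=
    aecover_Ioi_of_Ioi (tendsto_nhdsWithin_of_tendsto_nhds tendsto_id)
  refine (hcover.integral_tendsto_of_countably_generated heven).congr' ?_
  filter_upwards [self_mem_nhdsWithin] with ε hε
  rw [setIntegral_lt_abs hε (hF ε hε), Measure.restrict_restrict measurableSet_Ioi,
    Set.Ioi_inter_Ioi, max_eq_left (le_of_lt hε)]

end PrincipalValue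

/-- The integral of the even density over `s > |q|` if `y > 0`, and over `0 < s < |q|` if
`y < 0`. -/
def cutIntegral (k k' c c' X y r q : ℝ) : ℝ :=
  ∫ s in Set.Ioi (0 : ℝ), heaviside ((s ^ 2 - q ^ 2) * y) * evenDensity k k' c c' X y r s

section CutIntegral

variable (k k' c c' X r : ℝ) {y : ℝ}

lemma integrableOn_heaviside_mul_lineIntegrand (q : ℝ) {ε : ℝ} (hy : y ≠ 0) (hε : 0 < ε) :
    IntegrableOn (fun s : ℝ => (heaviside ((s ^ 2 - q ^ 2) * y) : ℂ) *
      lineIntegrand k k' c c' X y r s) {s | ε < |s|} := by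
  refine Integrable.mono' ((integrable_heaviside_mul_gaussian hy q).integrableOn.mul_const
    (expPhase r X y * (1 + |c| / ε + |c'| / ε)))
    (Measurable.aestronglyMeasurable (by fun_prop))
    ((ae_restrict_iff' (measurableSet_lt measurable_const (by fun_prop))).2
      (Eventually.of_forall fun s hs => ?_))
  have hH := (heaviside_mem_Icc ((s ^ 2 - q ^ 2) * y)).1
  calc ‖(heaviside ((s ^ 2 - q ^ 2) * y) : ℂ) * lineIntegrand k k' c c' X y r s‖
      = heaviside ((s ^ 2 - q ^ 2) * y) * Real.exp (-(s ^ 2 * y)) *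
          (expPhase r X y * ‖twoPole k k' c c' (r + Complex.I * s)‖) := by
        rw [lineIntegrand, norm_mul, norm_mul, norm_exp_line, Complex.norm_real,
          Real.norm_of_nonneg hH]
        ring
    _ ≤ _ := mul_le_mul_of_nonneg_left
        (mul_le_mul_of_nonneg_left (norm_twoPole_le k k' c c' r hε (le_of_lt hs))
          (expPhase_pos r X y).le) (by positivity)

lemma integrable_heaviside_mul_evenDensity (q : ℝ) (hy : y ≠ 0) :
    Integrable fun s : ℝ =>
      heaviside ((s ^ 2 - q ^ 2) * y) * evenDensity k k' c c' X y r s := by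
  simp only [evenDensity, ← mul_assoc (heaviside _)]
  exact (integrable_heaviside_mul_gaussian hy q).mul_bdd (c := _)
    (Measurable.aestronglyMeasurable (by fun_prop))
    (Eventually.of_forall (abs_cos_add_oscKernel_add_oscKernel_le _ _ _ _ _ _))

lemma pvIntegral_heaviside_mul_lineIntegrand (q : ℝ) (hy : y ≠ 0) :
    pvIntegral (fun s => (heaviside ((s ^ 2 - q ^ 2) * y) : ℂ) * lineIntegrand k k' c c' X y r s) =
      ((2 * expPhase r X y * cutIntegral k k' c c' X y r q : ℝ) : ℂ) := by
  have hsum : ∀ s : ℝ, (heaviside ((s ^ 2 - q ^ 2) * y) : ℂ) * lineIntegrand k k' c c' X y r s +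
      heaviside (((-s) ^ 2 - q ^ 2) * y) * lineIntegrand k k' c c' X y r (-s) =
      ((2 * expPhase r X y *
        (heaviside ((s ^ 2 - q ^ 2) * y) * evenDensity k k' c c' X y r s) : ℝ) : ℂ) := fun s => by
    rw [neg_sq, ← mul_add, lineIntegrand_add_neg]
    push_cast
    ring
  have heven : Integrable fun s : ℝ => ((2 * expPhase r X y *
      (heaviside ((s ^ 2 - q ^ 2) * y) * evenDensity k k' c c' X y r s) : ℝ) : ℂ) :=
    ((integrable_heaviside_mul_evenDensity k k' c c' X r q hy).const_mul _).ofReal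
  have hlim := tendsto_setIntegral_lt_abs
    (fun ε hε => integrableOn_heaviside_mul_lineIntegrand k k' c c' X r q hy hε)
    (by simpa only [hsum] using heven.integrableOn)
  simp only [hsum, integral_complex_ofReal, integral_const_mul] at hlim
  exact hlim.limUnder_eq

lemma cutIntegral_of_pos {q : ℝ} (hy : 0 < y) (hq : 0 ≤ q) :
    cutIntegral k k' c c' X y r q = ∫ s in Set.Ioi q, evenDensity k k' c c' X y r s := by
  have hinter : Set.Ioi q = Set.Ioi 0 ∩ Set.Ioi q := by
    rw [Set.Ioi_inter_Ioi, max_eq_right hq]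
  rw [hinter, ← setIntegral_indicator measurableSet_Ioi]
  refine setIntegral_congr_ae measurableSet_Ioi ?_
  filter_upwards [Measure.ae_ne volume q] with s hsq hs
  have hs0 : 0 < s := hs
  rcases lt_or_gt_of_ne hsq with h | h
  · rw [Set.indicator_of_notMem (by simpa using h.le), heaviside_of_neg, zero_mul]
    exact mul_neg_of_neg_of_pos (by nlinarith) hy
  · rw [Set.indicator_of_mem (by simpa using h), heaviside_of_pos, one_mul]
    exact mul_pos (by nlinarith) hy

lemma cutIntegral_of_neg {q : ℝ} (hy : y < 0) (hq : 0 ≤ q) :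
    cutIntegral k k' c c' X y r q = ∫ s in (0 : ℝ)..q, evenDensity k k' c c' X y r s := by
  have hinter : Set.Ioc 0 q = Set.Ioi 0 ∩ Set.Iic q := Set.Ioi_inter_Iic.symm
  rw [intervalIntegral.integral_of_le hq, hinter, ← setIntegral_indicator measurableSet_Iic]
  refine setIntegral_congr_ae measurableSet_Ioi ?_
  filter_upwards [Measure.ae_ne volume q] with s hsq hs
  have hs0 : 0 < s := hs
  rcases lt_or_gt_of_ne hsq with h | h
  · rw [Set.indicator_of_mem (by simpa using h.le), heaviside_of_pos, one_mul]
    exact mul_pos_of_neg_of_neg (by nlinarith) hy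
  · rw [Set.indicator_of_notMem (by simpa using h), heaviside_of_neg, zero_mul]
    exact mul_neg_of_pos_of_neg (by nlinarith) hy

end CutIntegral

/-! ### The Green function in terms of residues -/

/-- The Green function `𝒢` at the spectral parameter `r ± i q`, in terms of the residues `c`, `c'`
of `χ ξ` and of the differences `X`, `y` of the coordinates. -/
def realGreen (k k' c c' X y r q : ℝ) : ℝ :=
  -(Real.sign y / Real.pi) * expPhase r X y * cutIntegral k k' c c' X y r q -
    heaviside (-y) * (heaviside (r - k) * (c * expPhase k X y) +
      heaviside (r - k') * (c' * expPhase k' X y))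

/-- The part of `𝒢` that does not depend on the spectral parameter. -/
def background (k k' c c' X y : ℝ) : ℝ :=
  if 0 < y then
    -(Real.sqrt (Real.pi / y) / (2 * Real.pi) * Real.exp (-(X ^ 2 / (4 * y))) +
      (c * expPhase k X y * erfPi y (X + 2 * k * y) +
        c' * expPhase k' X y * erfPi y (X + 2 * k' * y)) / (2 * Real.pi))
  else 0

section RealGreen

variable (k k' c c' X y r q : ℝ)

lemma realGreen_swap : realGreen k k' c c' X y r q = realGreen k' k c' c X y r q := by
  unfold realGreen cutIntegral
  simp only [evenDensity_swap k k']
  ring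

lemma background_swap : background k k' c c' X y = background k' k c' c X y := by
  unfold background
  split_ifs <;> ring

lemma expPhase_eq_mul :
    expPhase r X y = expPhase k X y *
      Real.exp ((r - k) * (X + 2 * k * y) + (r - k) ^ 2 * y) := by
  unfold expPhase
  rw [← Real.exp_add]
  congr 1
  ring

variable {y}

lemma expPhase_mul_exp_neg_sq_div (hy : y ≠ 0) :
    expPhase r X y * Real.exp (-((X + 2 * r * y) ^ 2 / (4 * y))) =
      Real.exp (-(X ^ 2 / (4 * y))) := by
  unfold expPhase
  rw [← Real.exp_add]
  congr 1
  field_simp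
  ring

lemma expPhase_mul_integral_oscKernel (hy : 0 < y) :
    expPhase r X y *
      ∫ s in Set.Ioi (0 : ℝ), Real.exp (-(s ^ 2 * y)) * oscKernel (r - k) (X + 2 * r * y) s =
    expPhase k X y * ((erfPi y (X + 2 * k * y) + Real.pi * Real.sign (r - k)) / 2) := by
  rw [← poleIntegral_eq hy, expPhase_eq_mul k X y r, poleIntegral, mul_assoc,
    show X + 2 * k * y + 2 * (r - k) * y = X + 2 * r * y by ring]

lemma expPhase_mul_integral_evenDensity (hy : 0 < y) :
    expPhase r X y * ∫ s in Set.Ioi (0 : ℝ), evenDensity k k' c c' X y r s =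
      Real.sqrt (Real.pi / y) / 2 * Real.exp (-(X ^ 2 / (4 * y))) +
        c * (expPhase k X y *
          ((erfPi y (X + 2 * k * y) + Real.pi * Real.sign (r - k)) / 2)) +
        c' * (expPhase k' X y *
          ((erfPi y (X + 2 * k' * y) + Real.pi * Real.sign (r - k')) / 2)) := by
  have hosc : ∀ p, IntegrableOn (fun s : ℝ => Real.exp (-(s ^ 2 * y)) *
      oscKernel (r - p) (X + 2 * r * y) s) (Set.Ioi 0) := fun p =>
    (integrable_gaussian_mul hy (by fun_prop) (abs_oscKernel_le _ _)).integrableOn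
  have hcos : IntegrableOn (fun s : ℝ => Real.exp (-(s ^ 2 * y)) *
      Real.cos (s * (X + 2 * r * y))) (Set.Ioi 0) :=
    (integrable_gaussian_mul hy (by fun_prop) fun s => Real.abs_cos_le_one _).integrableOn
  have hadd : IntegrableOn (fun s : ℝ => Real.exp (-(s ^ 2 * y)) *
      Real.cos (s * (X + 2 * r * y)) + c * (Real.exp (-(s ^ 2 * y)) *
        oscKernel (r - k) (X + 2 * r * y) s)) (Set.Ioi 0) := hcos.add ((hosc k).const_mul c)
  have hsplit : ∀ s, evenDensity k k' c c' X y r s =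
      Real.exp (-(s ^ 2 * y)) * Real.cos (s * (X + 2 * r * y)) +
        c * (Real.exp (-(s ^ 2 * y)) * oscKernel (r - k) (X + 2 * r * y) s) +
        c' * (Real.exp (-(s ^ 2 * y)) * oscKernel (r - k') (X + 2 * r * y) s) := fun s => by
    unfold evenDensity
    ring
  simp only [hsplit]
  rw [integral_add hadd ((hosc k').const_mul c'),
    integral_add hcos ((hosc k).const_mul c), integral_const_mul, integral_const_mul,
    integral_Ioi_gaussian_mul_cos hy, ← expPhase_mul_integral_oscKernel k X r hy,
    ← expPhase_mul_integral_oscKernel k' X r hy, ← expPhase_mul_exp_neg_sq_div X r hy.ne']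
  ring

variable {k k' c c' X q}

/-- The spectral parameter enters `𝒢` only through the signs of `r - k`, `r - k'` and an integral
over a segment. For `y > 0` this is the integral over the whole half line, evaluated in closed
form, minus the segment; for `y < 0` only the segment was present from the start. -/
lemma realGreen_eq (hy : y ≠ 0) (hq : 0 ≤ q)
    (hc : c * expPhase k X y + c' * expPhase k' X y = 0) :
    realGreen k k' c c' X y r q = background k k' c c' X y -
      (c * expPhase k X y * Real.sign (r - k) +
        c' * expPhase k' X y * Real.sign (r - k')) / 2 +
      expPhase r X y / Real.pi * ∫ s in (0 : ℝ)..q, evenDensity k k' c c' X y r s := by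
  unfold realGreen background
  rcases hy.lt_or_gt with hy | hy
  · rw [if_neg hy.not_gt, cutIntegral_of_neg _ _ _ _ _ _ hy hq, Real.sign_of_neg hy,
      heaviside_of_pos (neg_pos.2 hy), heaviside_eq_sign, heaviside_eq_sign]
    linear_combination (-1 / 2) * hc
  · have hsegment := intervalIntegral.integral_Ioi_sub_Ioi
      (integrable_evenDensity k k' c c' X r hy).integrableOn hq
    have hline := expPhase_mul_integral_evenDensity k k' c c' X r hy
    rw [if_pos hy, cutIntegral_of_pos _ _ _ _ _ _ hy hq, Real.sign_of_pos hy,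
      heaviside_of_neg (neg_neg_of_pos hy), ← hsegment, zero_mul, sub_zero]
    generalize Real.exp (-(X ^ 2 / (4 * y))) = g, erfPi y (X + 2 * k * y) = e,
      erfPi y (X + 2 * k' * y) = e', Real.sqrt (Real.pi / y) = w at hline ⊢
    field_simp
    linear_combination (-2) * hline

end RealGreen

/-! ### Uniform bounds -/

/-- The weight `1 + 1 / √|y|` of the estimates, `y` being the difference of the times. -/
def timeWeight (y : ℝ) : ℝ := 1 + 1 / Real.sqrt |y|

lemma one_le_timeWeight (y : ℝ) : 1 ≤ timeWeight y :=
  le_add_of_nonneg_right (by positivity)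

lemma sqrt_pi_div_le {y : ℝ} (hy : 0 < y) : Real.sqrt (Real.pi / y) / 2 ≤ 1 / Real.sqrt y := by
  have hpi : Real.sqrt Real.pi ≤ 2 := by
    rw [Real.sqrt_le_left (by norm_num)]
    linarith [Real.pi_le_four]
  rw [Real.sqrt_div Real.pi_pos.le, div_div, div_le_div_iff₀ (by positivity) (by positivity)]
  nlinarith [Real.sqrt_nonneg y]

section ShiftedGaussian

variable {y q a C : ℝ} {f : ℝ → ℝ}

lemma integrable_shifted_gaussian_mul (hy : 0 < y) (p : ℝ) (hf : Measurable f)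
    (h : ∀ s, |f s| ≤ C) : Integrable fun s : ℝ => Real.exp (-((s ^ 2 - p) * y)) * f s := by
  have hfactor : ∀ s : ℝ, Real.exp (-((s ^ 2 - p) * y)) * f s =
      Real.exp (p * y) * (Real.exp (-(s ^ 2 * y)) * f s) := fun s => by
    rw [← mul_assoc, ← Real.exp_add]
    ring_nf
  simpa only [hfactor] using (integrable_gaussian_mul hy hf h).const_mul (Real.exp (p * y))

lemma integrable_shifted_gaussian (hy : 0 < y) (p : ℝ) :
    Integrable fun s : ℝ => Real.exp (-((s ^ 2 - p) * y)) := by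
  simpa using integrable_shifted_gaussian_mul hy p (f := fun _ => 1) measurable_const
    fun _ => le_rfl

lemma integral_Ioi_shifted_gaussian_le (hy : 0 < y) (hq : 0 ≤ q) :
    ∫ s in Set.Ioi q, Real.exp (-((s ^ 2 - q ^ 2) * y)) ≤ 1 / Real.sqrt y :=
  calc ∫ s in Set.Ioi q, Real.exp (-((s ^ 2 - q ^ 2) * y))
      ≤ ∫ s in Set.Ioi q, Real.exp (-((s - q) ^ 2 * y)) := by
        refine setIntegral_mono_on (integrable_shifted_gaussian hy _).integrableOn
          ((integrable_gaussian hy).comp_sub_right q).integrableOn measurableSet_Ioi fun s hs => ?_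
        have hqs : q < s := hs
        exact Real.exp_le_exp.2 (neg_le_neg (mul_le_mul_of_nonneg_right (by nlinarith) hy.le))
    _ = ∫ s in Set.Ioi (0 : ℝ), Real.exp (-(s ^ 2 * y)) := by
        rw [← (measurePreserving_sub_right volume q).setIntegral_preimage_emb
          (measurableEmbedding_subRight q) (fun s : ℝ => Real.exp (-(s ^ 2 * y))) (Set.Ioi 0)]
        congr 2
        ext s
        simp
    _ = Real.sqrt (Real.pi / y) / 2 := by
        simpa only [neg_mul, mul_comm y] using integral_gaussian_Ioi y
    _ ≤ _ := sqrt_pi_div_le hy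

lemma abs_integral_Ioi_shifted_gaussian_mul_le (hy : 0 < y) (hq : 0 ≤ q) (hqa : q ≤ a)
    (hf : ∀ s > a, |f s| ≤ C) :
    |∫ s in Set.Ioi a, Real.exp (-((s ^ 2 - q ^ 2) * y)) * f s| ≤ 1 / Real.sqrt y * C := by
  have hC : 0 ≤ C := (abs_nonneg _).trans (hf (a + 1) (lt_add_one a))
  have hgauss := integrable_shifted_gaussian hy (q ^ 2)
  calc |∫ s in Set.Ioi a, Real.exp (-((s ^ 2 - q ^ 2) * y)) * f s|
      ≤ ∫ s in Set.Ioi a, Real.exp (-((s ^ 2 - q ^ 2) * y)) * C := by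
        rw [← Real.norm_eq_abs]
        refine norm_integral_le_of_norm_le (hgauss.integrableOn.mul_const C)
          ((ae_restrict_iff' measurableSet_Ioi).2 (Eventually.of_forall fun s hs => ?_))
        rw [Real.norm_eq_abs, abs_mul, Real.abs_exp]
        exact mul_le_mul_of_nonneg_left (hf s hs) (Real.exp_nonneg _)
    _ = (∫ s in Set.Ioi a, Real.exp (-((s ^ 2 - q ^ 2) * y))) * C := integral_mul_const _ _
    _ ≤ (∫ s in Set.Ioi q, Real.exp (-((s ^ 2 - q ^ 2) * y))) * C := by
        refine mul_le_mul_of_nonneg_right (setIntegral_mono_set hgauss.integrableOn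
          (Eventually.of_forall fun s => Real.exp_nonneg _) ?_) hC
        exact (Set.Ioi_subset_Ioi hqa).eventuallyLE
    _ ≤ 1 / Real.sqrt y * C :=
        mul_le_mul_of_nonneg_right (integral_Ioi_shifted_gaussian_le hy hq) hC

/-- On `[q, q + 1]` the oscillation bounds the integral, beyond it the kernel is at most `1`. -/
lemma abs_integral_Ioi_shifted_gaussian_mul_oscKernel_le (hy : 0 < y) (hq : 0 ≤ q) (δ A : ℝ) :
    |∫ s in Set.Ioi q, Real.exp (-((s ^ 2 - q ^ 2) * y)) * oscKernel δ A s| ≤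
      16 + 1 / Real.sqrt y := by
  have hsplit := intervalIntegral.integral_Ioi_sub_Ioi (integrable_shifted_gaussian_mul hy (q ^ 2)
    (measurable_oscKernel δ A) (abs_oscKernel_le δ A)).integrableOn (le_add_of_nonneg_right
      zero_le_one : q ≤ q + 1)
  have hnear := abs_integral_gaussian_mul_oscKernel_le δ A y (q ^ 2) hq
    (le_add_of_nonneg_right zero_le_one : q ≤ q + 1)
    fun s hs => mul_nonneg (by nlinarith [hs.1]) hy.le
  have htail := abs_integral_Ioi_shifted_gaussian_mul_le hy hq (a := q + 1) (C := 1)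
    (f := oscKernel δ A) (by linarith) fun s hs => by
      refine (abs_oscKernel_le_right δ A (by linarith)).trans ?_
      rw [div_le_one (by linarith)]
      linarith
  rw [sub_eq_iff_eq_add.1 hsplit]
  exact (abs_add_le _ _).trans (add_le_add hnear (by simpa using htail))

end ShiftedGaussian

lemma abs_cos_add_oscKernel_le {c' δ' : ℝ} (hc' : |c'| ≤ 2 * |δ'|) (A s : ℝ) :
    |Real.cos (s * A) + c' * oscKernel δ' A s| ≤ 3 := by
  have hosc : |c' * oscKernel δ' A s| ≤ 2 := by
    rcases eq_or_ne δ' 0 with rfl | hδ'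
    · have hzero : c' = 0 := by simpa using hc'
      simp [hzero]
    · calc |c' * oscKernel δ' A s| ≤ 2 * |δ'| * (1 / |δ'|) := by
            rw [abs_mul]
            exact mul_le_mul hc' (abs_oscKernel_le_left A s hδ') (abs_nonneg _) (by positivity)
        _ = 2 := by
            have := abs_ne_zero.2 hδ'
            field_simp
  exact (abs_add_le _ _).trans (by linarith [Real.abs_cos_le_one (s * A)])

section CutIntegralBound

variable {k k' c c' X y r q : ℝ}

lemma evenDensity_eq_shifted (k k' c c' X y r q s : ℝ) :
    evenDensity k k' c c' X y r s = Real.exp (-(q ^ 2 * y)) *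
      (c * (Real.exp (-((s ^ 2 - q ^ 2) * y)) * oscKernel (r - k) (X + 2 * r * y) s) +
        Real.exp (-((s ^ 2 - q ^ 2) * y)) * (Real.cos (s * (X + 2 * r * y)) +
          c' * oscKernel (r - k') (X + 2 * r * y) s)) := by
  have hgauss : Real.exp (-(s ^ 2 * y)) =
      Real.exp (-(q ^ 2 * y)) * Real.exp (-((s ^ 2 - q ^ 2) * y)) := by
    rw [← Real.exp_add]
    ring_nf
  rw [evenDensity, hgauss]
  ring

lemma abs_cutIntegral_le_of_pos (hc' : |c'| ≤ 2 * |r - k'|) (hq : 0 ≤ q) (hy : 0 < y) :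
    |cutIntegral k k' c c' X y r q| ≤ Real.exp (-(q ^ 2 * y)) *
      (|c| * (16 + 1 / Real.sqrt y) + 1 / Real.sqrt y * 3) := by
  have hregular := abs_cos_add_oscKernel_le hc' (X + 2 * r * y)
  rw [cutIntegral_of_pos _ _ _ _ _ _ hy hq]
  simp only [evenDensity_eq_shifted k k' c c' X y r q]
  rw [integral_const_mul, abs_mul, Real.abs_exp, integral_add
    ((integrable_shifted_gaussian_mul hy _ (by fun_prop)
      (abs_oscKernel_le _ _)).integrableOn.const_mul c)
    (integrable_shifted_gaussian_mul hy _ (by fun_prop) hregular).integrableOn,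
    integral_const_mul]
  refine mul_le_mul_of_nonneg_left ((abs_add_le _ _).trans (add_le_add ?_ ?_)) (Real.exp_nonneg _)
  · rw [abs_mul]
    exact mul_le_mul_of_nonneg_left
      (abs_integral_Ioi_shifted_gaussian_mul_oscKernel_le hy hq _ _) (abs_nonneg c)
  · exact abs_integral_Ioi_shifted_gaussian_mul_le hy hq le_rfl fun s _ => hregular s

lemma abs_cutIntegral_le_of_neg (hc' : |c'| ≤ 2 * |r - k'|) (hq : 0 ≤ q) (hy : y < 0) :
    |cutIntegral k k' c c' X y r q| ≤ Real.exp (-(q ^ 2 * y)) * (|c| * 16 + 3 * q) := by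
  have hregular := abs_cos_add_oscKernel_le hc' (X + 2 * r * y)
  have hexponent : ∀ s ∈ Set.Icc 0 q, 0 ≤ (s ^ 2 - q ^ 2) * y := fun s hs =>
    mul_nonneg_of_nonpos_of_nonpos (by nlinarith [hs.1, hs.2]) hy.le
  rw [cutIntegral_of_neg _ _ _ _ _ _ hy hq]
  simp only [evenDensity_eq_shifted k k' c c' X y r q]
  rw [intervalIntegral.integral_const_mul, abs_mul, Real.abs_exp, intervalIntegral.integral_add
    (((intervalIntegrable_oscKernel _ _ 0 q).continuousOn_mul (by fun_prop)).const_mul c)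
    ((intervalIntegrable_of_measurable_of_abs_le (by fun_prop) hregular 0 q).continuousOn_mul
      (by fun_prop)), intervalIntegral.integral_const_mul]
  refine mul_le_mul_of_nonneg_left ((abs_add_le _ _).trans (add_le_add ?_ ?_)) (Real.exp_nonneg _)
  · rw [abs_mul]
    exact mul_le_mul_of_nonneg_left
      (abs_integral_gaussian_mul_oscKernel_le _ _ _ _ le_rfl hq hexponent) (abs_nonneg c)
  · have hbound := intervalIntegral.norm_integral_le_of_norm_le_const (C := 3) (a := 0) (b := q)
      (f := fun s => Real.exp (-((s ^ 2 - q ^ 2) * y)) * (Real.cos (s * (X + 2 * r * y)) +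
        c' * oscKernel (r - k') (X + 2 * r * y) s)) fun s hs => by
        rw [Set.uIoc_of_le hq] at hs
        rw [norm_mul, Real.norm_eq_abs, Real.abs_exp]
        refine (mul_le_of_le_one_left (norm_nonneg _) (Real.exp_le_one_iff.2
          (neg_nonpos.2 (hexponent s ⟨hs.1.le, hs.2⟩)))).trans (hregular s)
    rwa [sub_zero, abs_of_nonneg hq] at hbound

end CutIntegralBound

/-- The size of the residues `c`, `c'` at `k`, `k'` is at most the distance of the poles, and their
contributions `c e^{k X + k² y}` and `c' e^{k' X + k'² y}` cancel. The product `χ(x, ·) ξ(x', ·)`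
has this property for `X = x₁ - x₁'`, `y = x₂ - x₂'`. -/
structure BalancedResidues (k k' c c' X y : ℝ) : Prop where
  ne : k ≠ k'
  abs_left_le : |c| ≤ |k - k'|
  abs_right_le : |c'| ≤ |k - k'|
  cancel : c * expPhase k X y + c' * expPhase k' X y = 0

section BalancedResidues

variable {k k' c c' X y r q : ℝ}

lemma BalancedResidues.symm (h : BalancedResidues k k' c c' X y) :
    BalancedResidues k' k c' c X y where
  ne := h.ne.symm
  abs_left_le := abs_sub_comm k k' ▸ h.abs_right_le
  abs_right_le := abs_sub_comm k k' ▸ h.abs_left_le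
  cancel := by rw [add_comm, h.cancel]

lemma BalancedResidues.mul_expPhase_eq_neg (h : BalancedResidues k k' c c' X y) :
    c' * expPhase k' X y = -(c * expPhase k X y) :=
  eq_neg_of_add_eq_zero_right h.cancel

lemma BalancedResidues.abs_mul_expPhase_le (h : BalancedResidues k k' c c' X y) :
    |c * expPhase k X y| ≤ |k - k'| * min (expPhase k X y) (expPhase k' X y) := by
  rw [mul_min_of_nonneg _ _ (abs_nonneg _)]
  refine le_min ?_ ?_
  · rw [abs_mul, abs_of_pos (expPhase_pos k X y)]
    exact mul_le_mul_of_nonneg_right h.abs_left_le (expPhase_pos k X y).le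
  · rw [← abs_neg, ← h.mul_expPhase_eq_neg, abs_mul, abs_of_pos (expPhase_pos k' X y)]
    exact mul_le_mul_of_nonneg_right h.abs_right_le (expPhase_pos k' X y).le

/-- For `y ≤ 0` the exponent `r X + r² y` is concave in `r`. -/
lemma min_expPhase_le (hr : r ∈ Set.Icc k k') (hy : y ≤ 0) :
    min (expPhase k X y) (expPhase k' X y) ≤ expPhase r X y := by
  rw [min_le_iff]
  rcases le_total 0 (X + (r + k) * y) with hslope | hslope
  · refine Or.inl (Real.exp_le_exp.2 ?_)
    nlinarith [mul_nonneg (sub_nonneg.2 hr.1) hslope]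
  · refine Or.inr (Real.exp_le_exp.2 ?_)
    have hslope' : X + (r + k') * y ≤ 0 := by nlinarith [hr.1.trans hr.2]
    nlinarith [mul_nonneg_of_nonpos_of_nonpos (sub_nonpos.2 hr.2) hslope']

lemma BalancedResidues.abs_discrete_le (h : BalancedResidues k k' c c' X y) (hy : y ≤ 0) :
    |heaviside (r - k) * (c * expPhase k X y) + heaviside (r - k') * (c' * expPhase k' X y)| ≤
      |k - k'| * expPhase r X y := by
  wlog hk : k < k' generalizing k k' c c'
  · rw [add_comm, abs_sub_comm k k']
    exact this h.symm (lt_of_le_of_ne (not_lt.1 hk) h.ne.symm)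
  have hbound : 0 ≤ |k - k'| * expPhase r X y :=
    mul_nonneg (abs_nonneg _) (expPhase_pos r X y).le
  rw [h.mul_expPhase_eq_neg, mul_neg, ← sub_eq_add_neg, ← sub_mul, abs_mul]
  rcases lt_or_ge r k with hr | hr
  · rw [heaviside_of_neg (by linarith), heaviside_of_neg (by linarith)]
    simpa using hbound
  rcases lt_or_ge k' r with hr' | hr'
  · rw [heaviside_of_pos (by linarith), heaviside_of_pos (by linarith)]
    simpa using hbound
  have hheaviside : |heaviside (r - k) - heaviside (r - k')| ≤ 1 :=
    abs_sub_le_of_nonneg_of_le (heaviside_mem_Icc _).1 (heaviside_mem_Icc _).2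
      (heaviside_mem_Icc _).1 (heaviside_mem_Icc _).2
  exact (mul_le_of_le_one_left (abs_nonneg _) hheaviside).trans (h.abs_mul_expPhase_le.trans
    (mul_le_mul_of_nonneg_left (min_expPhase_le ⟨hr, hr'⟩ hy) (abs_nonneg _)))

lemma BalancedResidues.abs_right_le_two_mul (h : BalancedResidues k k' c c' X y)
    (hr : |r - k| ≤ |k - k'| / 2) : |c'| ≤ 2 * |r - k'| := by
  have htriangle : |k - k'| ≤ |r - k| + |r - k'| := by
    rw [abs_sub_comm r k]
    exact abs_sub_le k r k'
  linarith [h.abs_right_le]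

lemma BalancedResidues.abs_cutIntegral_le (h : BalancedResidues k k' c c' X y)
    (hr : |r - k| ≤ |k - k'| / 2) (hq : 0 ≤ q) (hqk : q ≤ |k - k'| / 2) (hy : y ≠ 0) :
    |cutIntegral k k' c c' X y r q| ≤
      Real.exp (-(q ^ 2 * y)) * ((18 * |k - k'| + 3) * timeWeight y) := by
  have hc' := h.abs_right_le_two_mul hr
  have hc := h.abs_left_le
  have hw := one_le_timeWeight y
  rcases hy.lt_or_gt with hy | hy
  · refine (abs_cutIntegral_le_of_neg hc' hq hy).trans
      (mul_le_mul_of_nonneg_left ?_ (Real.exp_nonneg _))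
    nlinarith [abs_nonneg (k - k')]
  · refine (abs_cutIntegral_le_of_pos hc' hq hy).trans
      (mul_le_mul_of_nonneg_left ?_ (Real.exp_nonneg _))
    have hsqrt : 0 ≤ 1 / Real.sqrt y := by positivity
    rw [timeWeight, abs_of_pos hy]
    nlinarith [mul_le_mul_of_nonneg_right hc hsqrt, abs_nonneg (k - k')]

lemma BalancedResidues.abs_realGreen_le (h : BalancedResidues k k' c c' X y)
    (hr : |r - k| ≤ |k - k'| / 2) (hq : 0 ≤ q) (hqk : q ≤ |k - k'| / 2) (hy : y ≠ 0) :
    |realGreen k k' c c' X y r q| ≤ (19 * |k - k'| + 3) * timeWeight y *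
      (expPhase r X y * Real.exp (-(q ^ 2 * y))) := by
  have hE := expPhase_pos r X y
  have hsign : |-(Real.sign y / Real.pi)| ≤ 1 := by
    rw [abs_neg, abs_div, abs_of_pos Real.pi_pos, div_le_one Real.pi_pos]
    rcases Real.sign_apply_eq y with hs | hs | hs <;> rw [hs] <;> norm_num <;>
      linarith [Real.pi_gt_three]
  have hcontinuous : |-(Real.sign y / Real.pi) * expPhase r X y * cutIntegral k k' c c' X y r q| ≤
      expPhase r X y * (Real.exp (-(q ^ 2 * y)) * ((18 * |k - k'| + 3) * timeWeight y)) := by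
    rw [mul_assoc, abs_mul, abs_mul (expPhase r X y), abs_of_pos hE]
    exact (mul_le_of_le_one_left (by positivity) hsign).trans
      (mul_le_mul_of_nonneg_left (h.abs_cutIntegral_le hr hq hqk hy) hE.le)
  have hdiscrete : |heaviside (-y) * (heaviside (r - k) * (c * expPhase k X y) +
      heaviside (r - k') * (c' * expPhase k' X y))| ≤
      |k - k'| * (expPhase r X y * Real.exp (-(q ^ 2 * y))) := by
    rcases hy.lt_or_gt with hy | hy
    · rw [heaviside_of_pos (neg_pos.2 hy), one_mul]
      refine (h.abs_discrete_le hy.le).trans (mul_le_mul_of_nonneg_left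
        (le_mul_of_one_le_right hE.le (Real.one_le_exp ?_)) (abs_nonneg _))
      nlinarith [sq_nonneg q]
    · rw [heaviside_of_neg (neg_neg_of_pos hy), zero_mul, abs_zero]
      positivity
  have hscale : 0 ≤ |k - k'| * (expPhase r X y * Real.exp (-(q ^ 2 * y))) := by positivity
  unfold realGreen
  refine (abs_sub _ _).trans ((add_le_add hcontinuous hdiscrete).trans ?_)
  nlinarith [mul_le_mul_of_nonneg_left (one_le_timeWeight y) hscale]

end BalancedResidues

/-! ### Expansion near a pole -/

lemma arg_eq_arctan {z : ℂ} (hz : 0 < z.re) : z.arg = Real.arctan (z.im / z.re) := by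
  obtain ⟨hlower, hupper⟩ := abs_lt.1 (Complex.abs_arg_lt_pi_div_two_iff.2 (Or.inl hz))
  rw [← Complex.tan_arg, Real.arctan_tan hlower hupper]

lemma arccotAbs_of_pos {p : ℝ} (hp : 0 < p) (q : ℝ) :
    arccotAbs p q = Real.arctan (|q| / p) := by
  simpa [arccotAbs] using arg_eq_arctan (z := p + |q| * Complex.I) (by simpa using hp)

lemma arccotAbs_zero_left {q : ℝ} (hq : q ≠ 0) : arccotAbs 0 q = Real.pi / 2 := by
  rw [arccotAbs, Complex.ofReal_zero, zero_add, Complex.arg_real_mul _ (abs_pos.2 hq),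
    Complex.arg_I]

lemma arccotAbs_neg {p : ℝ} (hp : 0 < p) (q : ℝ) :
    arccotAbs (-p) q = Real.pi - arccotAbs p q := by
  rcases eq_or_ne q 0 with rfl | hq
  · simp only [arccotAbs, abs_zero, Complex.ofReal_zero, zero_mul, add_zero]
    rw [Complex.arg_ofReal_of_neg (neg_neg_of_pos hp), Complex.arg_ofReal_of_nonneg hp.le,
      sub_zero]
  · have him : 0 < ((p : ℂ) + |q| * Complex.I).im := by simpa using abs_pos.2 hq
    have hconj : ((-p : ℝ) : ℂ) + |q| * Complex.I =
        -starRingEnd ℂ ((p : ℂ) + |q| * Complex.I) := by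
      simp [Complex.conj_ofReal, add_comm]
    rw [arccotAbs, arccotAbs, hconj,
      Complex.arg_neg_eq_arg_add_pi_of_im_neg (by simpa using hq), Complex.arg_conj, if_neg,
      neg_add_eq_sub]
    intro harg
    rw [Complex.arg_eq_pi_iff] at harg
    exact him.ne' harg.2

lemma arctan_sub_sign_eq_arccotAbs {p q : ℝ} (h : p ≠ 0 ∨ q ≠ 0) :
    Real.arctan (|q| / p) / Real.pi - Real.sign p / 2 = arccotAbs p q / Real.pi - 1 / 2 := by
  have hpi := Real.pi_ne_zero
  rcases lt_trichotomy p 0 with hp | rfl | hp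
  · obtain ⟨p, rfl⟩ : ∃ p', p = -p' := ⟨-p, (neg_neg p).symm⟩
    have hp' : 0 < p := neg_lt_zero.1 hp
    rw [arccotAbs_neg hp', arccotAbs_of_pos hp', Real.sign_of_neg hp, div_neg, Real.arctan_neg]
    field_simp
    ring
  · rw [arccotAbs_zero_left (by simpa using h), Real.sign_zero, div_zero, Real.arctan_zero]
    field_simp
    ring
  · rw [arccotAbs_of_pos hp, Real.sign_of_pos hp]

lemma arctan_sub_sign_eq_mul_arccotAbs {σ p q : ℝ} (hσ : σ = -1 ∨ σ = 1) (h : p ≠ 0 ∨ q ≠ 0) :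
    Real.arctan (|q| / p) / Real.pi - Real.sign p / 2 =
      σ * (arccotAbs (σ * p) q / Real.pi - 1 / 2) := by
  rcases hσ with rfl | rfl
  · rw [neg_one_mul, neg_one_mul, ← arctan_sub_sign_eq_arccotAbs (by simpa using h), div_neg,
      Real.arctan_neg, Real.sign_neg]
    ring
  · rw [one_mul, one_mul, arctan_sub_sign_eq_arccotAbs h]

lemma arccotAbs_mul {ρ : ℝ} (hρ : 0 < ρ) (p q : ℝ) :
    arccotAbs (ρ * p) (ρ * q) = arccotAbs p q := by
  unfold arccotAbs
  rw [← Complex.arg_real_mul ((p : ℂ) + |q| * Complex.I) hρ, abs_mul, abs_of_pos hρ]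
  congr 1
  push_cast
  ring

lemma abs_arccotAbs_div_pi_le (p q : ℝ) : |arccotAbs p q / Real.pi| ≤ 1 := by
  rw [abs_div, abs_of_pos Real.pi_pos, div_le_one Real.pi_pos]
  exact Complex.abs_arg_le_pi _

/-- The increment of the phase `μ X + μ² y` from `μ = k` to `μ = k + z`. -/
def localPhase (k X y : ℝ) (z : ℂ) : ℂ := z * (X + 2 * k * y) + z ^ 2 * y

/-- A Lipschitz constant of `localPhase` at `0`, on the disc of radius `|k - k'|`. -/
def poleScale (k k' X y : ℝ) : ℝ := (1 + 3 * (|k| + |k'|)) * (1 + (|X| + |y|))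

section LocalPhase

variable {k k' X y : ℝ}

lemma one_le_poleScale : 1 ≤ poleScale k k' X y := by
  refine one_le_mul_of_one_le_of_one_le ?_ ?_
  · linarith [abs_nonneg k, abs_nonneg k']
  · linarith [abs_nonneg X, abs_nonneg y]

lemma expPhase_mul_exp_localPhase (μ : ℂ) :
    expPhase k X y * Complex.exp (localPhase k X y (μ - k)) =
      Complex.exp (μ * X + μ ^ 2 * y) := by
  unfold expPhase localPhase
  push_cast
  rw [← Complex.exp_add]
  congr 1
  ring

lemma exp_neg_mul_expPhase (l : ℂ) :
    Complex.exp (-(l * X + l ^ 2 * y)) * expPhase k X y =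
      Complex.exp (-localPhase k X y (l - k)) := by
  rw [Complex.exp_neg, ← expPhase_mul_exp_localPhase (k := k), Complex.exp_neg, mul_inv,
    mul_right_comm, inv_mul_cancel₀ (Complex.ofReal_ne_zero.2 (expPhase_pos k X y).ne'), one_mul]

lemma norm_localPhase_le {z : ℂ} (hz : ‖z‖ ≤ |k - k'|) :
    ‖localPhase k X y z‖ ≤ ‖z‖ * poleScale k k' X y := by
  have hcoeff : ‖((X : ℂ) + 2 * k * y) + z * y‖ ≤ poleScale k k' X y := by
    calc ‖((X : ℂ) + 2 * k * y) + z * y‖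
        ≤ (‖(X : ℂ)‖ + ‖(2 : ℂ) * k * y‖) + ‖z * y‖ :=
          (norm_add_le _ _).trans (add_le_add (norm_add_le _ _) le_rfl)
      _ = |X| + (2 * |k| + ‖z‖) * |y| := by
          simp only [norm_mul, Complex.norm_real, Complex.norm_ofNat, Real.norm_eq_abs]
          ring
      _ ≤ |X| + 3 * (|k| + |k'|) * |y| := by
          gcongr
          linarith [abs_sub k k', abs_nonneg k']
      _ ≤ poleScale k k' X y := by
          have : 0 ≤ 3 * (|k| + |k'|) * (1 + |X|) := by positivity
          unfold poleScale
          nlinarith [abs_nonneg y]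
  rw [show localPhase k X y z = z * ((X + 2 * k * y) + z * y) by unfold localPhase; ring,
    norm_mul]
  exact mul_le_mul_of_nonneg_left hcoeff (norm_nonneg z)

end LocalPhase

/-- The regular value at `k` of the Green function `G` in the expansion about `k`. -/
def poleConst (k k' c c' X y : ℝ) : ℝ :=
  background k k' c c' X y / expPhase k X y - Real.sign (k' - k) * c

/-- The leading part at `k` of the Green function `G`: its regular value and the part depending on
the direction of `l - k`. The sign makes the formula the same at the lower and the upper pole. -/
def poleLeading (k k' c c' X y : ℝ) (l : ℂ) : ℝ :=
  poleConst k k' c c' X y +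
    Real.sign (k' - k) * c * (arccotAbs (Real.sign (k' - k) * (l.re - k)) l.im / Real.pi)

/-- The integral over the segment from `r` to `r + i q`, normalized by `e^{k X + k² y}`, without
the contribution of the polar part `c / (μ - k)`. -/
def segmentRemainder (k k' c c' X y r q : ℝ) : ℝ :=
  expPhase r X y / expPhase k X y * (∫ s in (0 : ℝ)..q, evenDensity k k' c c' X y r s) -
    c * Real.arctan (q / (r - k))

/-- The Green function `G` in terms of the residues `c`, `c'` of `χ ξ` and of the differences `X`,
`y` of the coordinates. -/
def reducedGreen (k k' c c' X y : ℝ) (l : ℂ) : ℂ :=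
  Complex.exp (-(l * X + l ^ 2 * y)) * (realGreen k k' c c' X y l.re |l.im| : ℝ)

/-- The remainder in the expansion of the Green function `G` about `k`. -/
def poleRemainder (k k' c c' X y : ℝ) (l : ℂ) : ℂ :=
  reducedGreen k k' c c' X y l - poleLeading k k' c c' X y l

/-- The constant, depending on the two poles only, in the bounds on the expansion about `k`. -/
def poleBound (k k' : ℝ) : ℝ := (11 + 22 * |k - k'|) * (1 + 3 * (|k| + |k'|))

lemma poleBound_comm (k k' : ℝ) : poleBound k k' = poleBound k' k := by
  unfold poleBound
  rw [abs_sub_comm, add_comm |k|]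

lemma le_poleBound (k k' : ℝ) : 11 + 22 * |k - k'| ≤ poleBound k k' :=
  le_mul_of_one_le_right (by positivity) (by linarith [abs_nonneg k, abs_nonneg k'])

section SegmentRemainder

variable {k k' c c' X y r q : ℝ}

lemma sign_sub_eq_sign_sub_of_abs_sub_lt (h : |r - k| < |k - k'| / 2) :
    Real.sign (r - k') = Real.sign (k - k') := by
  obtain ⟨hlower, hupper⟩ := abs_lt.1 h
  rcases lt_trichotomy (k - k') 0 with h0 | h0 | h0
  · rw [abs_of_neg h0] at hupper
    rw [Real.sign_of_neg h0, Real.sign_of_neg (by linarith)]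
  · rw [h0, abs_zero, zero_div] at h
    exact absurd h (abs_nonneg _).not_gt
  · rw [abs_of_pos h0] at hlower
    rw [Real.sign_of_pos h0, Real.sign_of_pos (by linarith)]

lemma segmentRemainder_eq_integral :
    segmentRemainder k k' c c' X y r q = ∫ s in (0 : ℝ)..q,
      (Complex.exp (localPhase k X y (r + Complex.I * s - k)) *
        twoPole k k' c c' (r + Complex.I * s) - c / (r + Complex.I * s - k)).re := by
  have hE := (expPhase_pos k X y).ne'
  have hregular (s : ℝ) : (Complex.exp (localPhase k X y (r + Complex.I * s - k)) *
      twoPole k k' c c' (r + Complex.I * s)).re =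
      expPhase r X y / expPhase k X y * evenDensity k k' c c' X y r s := by
    rw [div_mul_eq_mul_div, ← lineIntegrand_re, lineIntegrand,
      ← expPhase_mul_exp_localPhase (k := k), mul_assoc, Complex.re_ofReal_mul,
      mul_div_cancel_left₀ _ hE]
  have hpolar (s : ℝ) : ((c : ℂ) / (r + Complex.I * s - k)).re =
      c * ((r - k) / ((r - k) ^ 2 + s ^ 2)) := by
    rw [div_eq_mul_inv, Complex.re_ofReal_mul, Complex.inv_re, Complex.normSq_apply]
    simp [pow_two]
  simp only [Complex.sub_re, hregular, hpolar]
  rw [intervalIntegral.integral_sub ((intervalIntegrable_evenDensity ..).const_mul _)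
      ((intervalIntegrable_cauchy ..).const_mul _), intervalIntegral.integral_const_mul,
    intervalIntegral.integral_const_mul, integral_cauchy, zero_div, Real.arctan_zero, sub_zero,
    segmentRemainder]

/-- With `exp u = 1 + O(u)` the pole at `k` cancels. -/
lemma norm_exp_mul_twoPole_sub_le {u μ : ℂ} {M : ℝ} (hM : 0 ≤ M) (hu : ‖u‖ ≤ 1)
    (huM : ‖u‖ ≤ ‖μ - k‖ * M) (hc' : |c'| ≤ 2 * ‖μ - k'‖) :
    ‖Complex.exp u * twoPole k k' c c' μ - c / (μ - k)‖ ≤ 9 + 2 * |c| * M := by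
  have hexp : ‖Complex.exp u‖ ≤ 3 :=
    (Complex.norm_exp_le_exp_norm u).trans
      ((Real.exp_le_exp.2 hu).trans Real.exp_one_lt_three.le)
  have hfar : ‖1 + (c' : ℂ) / (μ - k')‖ ≤ 3 := by
    refine (norm_add_le _ _).trans ?_
    rw [norm_one, norm_div, Complex.norm_real, Real.norm_eq_abs]
    linarith [div_le_of_le_mul₀ (norm_nonneg _) zero_le_two hc']
  have hnear : ‖(Complex.exp u - 1) * (c / (μ - k))‖ ≤ 2 * |c| * M := by
    rw [norm_mul, norm_div, Complex.norm_real, Real.norm_eq_abs, ← mul_div_assoc]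
    refine div_le_of_le_mul₀ (norm_nonneg _) (by positivity) ?_
    calc ‖Complex.exp u - 1‖ * |c| ≤ 2 * (‖μ - k‖ * M) * |c| := by
          gcongr
          exact (Complex.norm_exp_sub_one_le hu).trans (by gcongr)
      _ = _ := by ring
  calc ‖Complex.exp u * twoPole k k' c c' μ - c / (μ - k)‖
      = ‖Complex.exp u * (1 + c' / (μ - k')) + (Complex.exp u - 1) * (c / (μ - k))‖ := by
        congr 1
        unfold twoPole
        ring
    _ ≤ ‖Complex.exp u‖ * ‖1 + (c' : ℂ) / (μ - k')‖ + 2 * |c| * M :=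
        (norm_add_le _ _).trans (add_le_add (norm_mul_le _ _) hnear)
    _ ≤ 9 + 2 * |c| * M := by
        linarith [mul_le_mul hexp hfar (norm_nonneg _) zero_le_three]

end SegmentRemainder

lemma reducedGreen_swap (k k' c c' X y : ℝ) (l : ℂ) :
    reducedGreen k k' c c' X y l = reducedGreen k' k c' c X y l := by
  unfold reducedGreen
  rw [realGreen_swap]

lemma reducedGreen_conj (k k' c c' X y : ℝ) (l : ℂ) :
    reducedGreen k k' c c' X y (starRingEnd ℂ l) =
      starRingEnd ℂ (reducedGreen k k' c c' X y l) := by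
  simp [reducedGreen, ← Complex.exp_conj, Complex.conj_ofReal]

lemma poleLeading_add_mul {k k' c c' X y r : ℝ} (hr : 0 < r) (z : ℂ) :
    poleLeading k k' c c' X y (k + r * z) = poleLeading k k' c c' X y (k + z) := by
  have hre : ((k : ℂ) + r * z).re - k = r * ((k + z : ℂ).re - k) := by simp
  have him : ((k : ℂ) + r * z).im = r * (k + z : ℂ).im := by simp
  rw [poleLeading, poleLeading, hre, him, mul_left_comm (Real.sign (k' - k)), arccotAbs_mul hr]

namespace BalancedResidues

variable {k k' c c' X y : ℝ} {l : ℂ}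

lemma sign_sub_eq (h : BalancedResidues k k' c c' X y) :
    Real.sign (k' - k) = -1 ∨ Real.sign (k' - k) = 1 :=
  Real.sign_apply_eq_of_ne_zero _ (sub_ne_zero.2 h.ne.symm)

lemma abs_sign_mul_le (h : BalancedResidues k k' c c' X y) :
    |Real.sign (k' - k) * c| ≤ |k - k'| := by
  rcases h.sign_sub_eq with hσ | hσ <;> rw [hσ] <;> simpa using h.abs_left_le

lemma abs_segmentRemainder_le (h : BalancedResidues k k' c c' X y)
    (hl : ‖l - k‖ ≤ |k - k'| / 2) (hsmall : ‖l - k‖ * poleScale k k' X y ≤ 1) :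
    |segmentRemainder k k' c c' X y l.re (|l.im|)| ≤
      ‖l - k‖ * (9 + 2 * |k - k'| * poleScale k k' X y) := by
  have hM : 0 ≤ poleScale k k' X y := zero_le_one.trans one_le_poleScale
  have hre : |l.re - k| ≤ ‖l - k‖ := by simpa using Complex.abs_re_le_norm (l - k)
  have him : |l.im| ≤ ‖l - k‖ := by simpa using Complex.abs_im_le_norm (l - k)
  have hnear (s : ℝ) (hs : |s| ≤ |l.im|) : ‖(l.re : ℂ) + Complex.I * s - k‖ ≤ ‖l - k‖ := by
    rw [Complex.norm_eq_sqrt_sq_add_sq, Complex.norm_eq_sqrt_sq_add_sq]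
    simpa using Real.sqrt_le_sqrt (add_le_add_right (sq_le_sq.2 hs) ((l.re - k) ^ 2))
  have hfar (s : ℝ) : |c'| ≤ 2 * ‖(l.re : ℂ) + Complex.I * s - k'‖ := by
    refine (h.abs_right_le_two_mul (hre.trans hl)).trans (mul_le_mul_of_nonneg_left ?_ zero_le_two)
    simpa using Complex.abs_re_le_norm ((l.re : ℂ) + Complex.I * s - k')
  rw [segmentRemainder_eq_integral, ← Real.norm_eq_abs]
  refine (intervalIntegral.norm_integral_le_of_norm_le_const
    (C := 9 + 2 * |k - k'| * poleScale k k' X y) fun s hs => ?_).trans ?_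
  · rw [Set.uIoc_of_le (abs_nonneg _)] at hs
    have hs' := hnear s ((abs_of_pos hs.1).trans_le hs.2)
    have hphase := norm_localPhase_le (X := X) (y := y)
      (hs'.trans (hl.trans (half_le_self (abs_nonneg (k - k')))))
    refine (Complex.abs_re_le_norm _).trans ((norm_exp_mul_twoPole_sub_le hM (hphase.trans
      ((mul_le_mul_of_nonneg_right hs' hM).trans hsmall)) hphase (hfar s)).trans ?_)
    linarith [mul_le_mul_of_nonneg_right h.abs_left_le hM]
  · rw [sub_zero, abs_abs, mul_comm]
    gcongr

lemma realGreen_eq_leading (h : BalancedResidues k k' c c' X y) (hy : y ≠ 0)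
    (hl₀ : l ≠ k) (hl : ‖l - k‖ < |k - k'| / 2) :
    realGreen k k' c c' X y l.re |l.im| = expPhase k X y * (poleLeading k k' c c' X y l +
      segmentRemainder k k' c c' X y l.re (|l.im|) / Real.pi) := by
  have hE := (expPhase_pos k X y).ne'
  have hpi := Real.pi_ne_zero
  have hne : l.re - k ≠ 0 ∨ l.im ≠ 0 := by
    by_contra! hzero
    exact hl₀ (Complex.ext (by simpa [sub_eq_zero] using hzero.1) (by simpa using hzero.2))
  have hre : |l.re - k| ≤ ‖l - k‖ := by simpa using Complex.abs_re_le_norm (l - k)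
  have hangle := arctan_sub_sign_eq_mul_arccotAbs h.sign_sub_eq hne
  have hsign : Real.sign (l.re - k') = -Real.sign (k' - k) := by
    rw [sign_sub_eq_sign_sub_of_abs_sub_lt (hre.trans_lt hl), ← Real.sign_neg, neg_sub]
  rw [realGreen_eq _ hy (abs_nonneg _) h.cancel, poleLeading, poleConst, segmentRemainder, hsign,
    h.mul_expPhase_eq_neg]
  generalize arccotAbs _ _ = ϑ, Real.sign (k' - k) = σ, Real.sign (l.re - k) = τ,
    Real.arctan _ = t at hangle ⊢
  field_simp at hangle ⊢
  linear_combination c * expPhase k X y * hangle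

lemma poleRemainder_eq (h : BalancedResidues k k' c c' X y) (hy : y ≠ 0) (hl₀ : l ≠ k)
    (hl : ‖l - k‖ < |k - k'| / 2) :
    poleRemainder k k' c c' X y l =
      (Complex.exp (-localPhase k X y (l - k)) - 1) * poleLeading k k' c c' X y l +
        Complex.exp (-localPhase k X y (l - k)) *
          (segmentRemainder k k' c c' X y l.re (|l.im|) / Real.pi : ℝ) := by
  rw [poleRemainder, reducedGreen, h.realGreen_eq_leading hy hl₀ hl, ← exp_neg_mul_expPhase]
  push_cast
  ring

lemma abs_background_div_le (h : BalancedResidues k k' c c' X y) :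
    |background k k' c c' X y / expPhase k X y| ≤ 1 / Real.sqrt |y| + |k - k'| := by
  unfold background
  split_ifs with hy
  · have hE := expPhase_pos k X y
    have hratio : Real.exp (-(X ^ 2 / (4 * y))) / expPhase k X y ≤ 1 := by
      rw [← expPhase_mul_exp_neg_sq_div X k hy.ne', mul_div_cancel_left₀ _ hE.ne',
        Real.exp_le_one_iff, neg_nonpos]
      positivity
    have hheat : Real.sqrt (Real.pi / y) / 2 / Real.pi ≤ 1 / Real.sqrt y :=
      (div_le_self (by positivity) (by linarith [Real.pi_gt_three])).trans (sqrt_pi_div_le hy)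
    have herf : |(erfPi y (X + 2 * k * y) - erfPi y (X + 2 * k' * y)) / (2 * Real.pi)| ≤ 1 := by
      rw [abs_div, abs_of_pos Real.two_pi_pos, div_le_one Real.two_pi_pos]
      refine (abs_sub _ _).trans ?_
      linarith [abs_erfPi_le hy (X + 2 * k * y), abs_erfPi_le hy (X + 2 * k' * y)]
    calc _ = |-(Real.sqrt (Real.pi / y) / 2 / Real.pi *
            (Real.exp (-(X ^ 2 / (4 * y))) / expPhase k X y)) -
          c * ((erfPi y (X + 2 * k * y) - erfPi y (X + 2 * k' * y)) / (2 * Real.pi))| := by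
          rw [h.mul_expPhase_eq_neg]
          congr 1
          field_simp
          ring
      _ ≤ Real.sqrt (Real.pi / y) / 2 / Real.pi *
            (Real.exp (-(X ^ 2 / (4 * y))) / expPhase k X y) + |c| * 1 := by
          refine (abs_sub _ _).trans ?_
          rw [abs_neg, abs_mul c, abs_of_nonneg (a := Real.sqrt _ / 2 / Real.pi * _)
            (mul_nonneg (by positivity) (by positivity))]
          gcongr
      _ ≤ 1 / Real.sqrt |y| + |k - k'| := by
          rw [mul_one, abs_of_pos hy]
          exact add_le_add ((mul_le_of_le_one_right (by positivity) hratio).trans hheat)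
            h.abs_left_le
  · rw [zero_div, abs_zero]
    positivity

lemma abs_poleConst_le (h : BalancedResidues k k' c c' X y) :
    |poleConst k k' c c' X y| ≤ (1 + 2 * |k - k'|) * timeWeight y := by
  have hw := one_le_timeWeight y
  refine (abs_sub _ _).trans ((add_le_add h.abs_background_div_le h.abs_sign_mul_le).trans ?_)
  unfold timeWeight at hw ⊢
  nlinarith [abs_nonneg (k - k')]

lemma abs_poleLeading_le (h : BalancedResidues k k' c c' X y) (l : ℂ) :
    |poleLeading k k' c c' X y l| ≤ (1 + 3 * |k - k'|) * timeWeight y := by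
  refine (abs_add_le _ _).trans ((add_le_add h.abs_poleConst_le ((abs_mul _ _).trans_le
    (mul_le_mul h.abs_sign_mul_le (abs_arccotAbs_div_pi_le _ _) (abs_nonneg _)
      (abs_nonneg _)))).trans ?_)
  nlinarith [abs_nonneg (k - k'), one_le_timeWeight y]

lemma norm_reducedGreen_le (h : BalancedResidues k k' c c' X y) (hy : y ≠ 0)
    (hl : ‖l - k‖ ≤ |k - k'| / 2) :
    ‖reducedGreen k k' c c' X y l‖ ≤ (19 * |k - k'| + 3) * timeWeight y := by
  have hre : |l.re - k| ≤ ‖l - k‖ := by simpa using Complex.abs_re_le_norm (l - k)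
  have him : |l.im| ≤ ‖l - k‖ := by simpa using Complex.abs_im_le_norm (l - k)
  have hnorm : ‖Complex.exp (-(l * X + l ^ 2 * y))‖ *
      (expPhase l.re X y * Real.exp (-(|l.im| ^ 2 * y))) = 1 := by
    unfold expPhase
    rw [Complex.norm_exp, ← Real.exp_add, ← Real.exp_add, Real.exp_eq_one_iff, sq_abs]
    simp only [Complex.neg_re, Complex.add_re, Complex.mul_re, Complex.ofReal_re,
      Complex.ofReal_im, pow_two]
    ring
  have hgreen := h.abs_realGreen_le (hre.trans hl) (abs_nonneg l.im) (him.trans hl) hy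
  rw [reducedGreen, norm_mul, Complex.norm_real, Real.norm_eq_abs]
  refine (mul_le_mul_of_nonneg_left hgreen (norm_nonneg _)).trans_eq ?_
  rw [mul_left_comm, hnorm, mul_one]

lemma norm_poleRemainder_le (h : BalancedResidues k k' c c' X y) (hy : y ≠ 0)
    (hl : ‖l - k‖ ≤ |k - k'| / 2) :
    ‖poleRemainder k k' c c' X y l‖ ≤ (22 * |k - k'| + 4) * timeWeight y := by
  refine (norm_sub_le _ _).trans ((add_le_add (h.norm_reducedGreen_le hy hl)
    ((Complex.norm_real _).trans_le (h.abs_poleLeading_le l))).trans_eq ?_)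
  ring

lemma norm_poleRemainder_le_of_small (h : BalancedResidues k k' c c' X y) (hy : y ≠ 0)
    (hl₀ : l ≠ k) (hl : ‖l - k‖ < |k - k'| / 2) (hsmall : ‖l - k‖ * poleScale k k' X y ≤ 1) :
    ‖poleRemainder k k' c c' X y l‖ ≤
      (11 + 8 * |k - k'|) * (timeWeight y * (poleScale k k' X y * ‖l - k‖)) := by
  have hw := one_le_timeWeight y
  have hM : 1 ≤ poleScale k k' X y := one_le_poleScale
  have hphase : ‖-localPhase k X y (l - k)‖ ≤ ‖l - k‖ * poleScale k k' X y := by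
    rw [norm_neg]
    exact norm_localPhase_le (hl.le.trans (half_le_self (abs_nonneg _)))
  have hexp : ‖Complex.exp (-localPhase k X y (l - k))‖ ≤ Real.pi :=
    (Complex.norm_exp_le_exp_norm _).trans ((Real.exp_le_exp.2 (hphase.trans hsmall)).trans
      (Real.exp_one_lt_three.le.trans Real.pi_gt_three.le))
  have hexp_sub := (Complex.norm_exp_sub_one_le (hphase.trans hsmall)).trans
    (mul_le_mul_of_nonneg_left hphase zero_le_two)
  have hsegment := h.abs_segmentRemainder_le hl.le hsmall
  have hleading := h.abs_poleLeading_le l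
  calc ‖poleRemainder k k' c c' X y l‖
      ≤ 2 * (‖l - k‖ * poleScale k k' X y) * ((1 + 3 * |k - k'|) * timeWeight y) +
          Real.pi * (‖l - k‖ * (9 + 2 * |k - k'| * poleScale k k' X y) / Real.pi) := by
        rw [h.poleRemainder_eq hy hl₀ hl]
        refine (norm_add_le _ _).trans ?_
        rw [norm_mul, norm_mul, Complex.norm_real, Complex.norm_real, Real.norm_eq_abs,
          Real.norm_eq_abs, abs_div, abs_of_pos Real.pi_pos]
        gcongr
    _ = ‖l - k‖ * (2 * (1 + 3 * |k - k'|) * (poleScale k k' X y * timeWeight y) + 9 +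
          2 * |k - k'| * poleScale k k' X y) := by
        rw [mul_div_cancel₀ _ Real.pi_ne_zero]
        ring
    _ ≤ ‖l - k‖ * (2 * (1 + 3 * |k - k'|) * (poleScale k k' X y * timeWeight y) +
          9 * (poleScale k k' X y * timeWeight y) +
          2 * |k - k'| * (poleScale k k' X y * timeWeight y)) := by
        have hone := one_le_mul_of_one_le_of_one_le hM hw
        have hself := le_mul_of_one_le_right (zero_le_one.trans hM) hw
        gcongr
        linarith
    _ = _ := by ring

/-- When `‖l - k‖` is not small compared to the phase, the uniform bound is already of the required
form. -/
lemma norm_poleRemainder_le_mul (h : BalancedResidues k k' c c' X y) (hy : y ≠ 0)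
    (hl₀ : l ≠ k) (hl : ‖l - k‖ < |k - k'| / 2) :
    ‖poleRemainder k k' c c' X y l‖ ≤
      poleBound k k' * timeWeight y * (1 + (|X| + |y|)) * ‖l - k‖ := by
  have hw : 0 ≤ timeWeight y := zero_le_one.trans (one_le_timeWeight y)
  have hM : 0 ≤ poleScale k k' X y := zero_le_one.trans one_le_poleScale
  calc ‖poleRemainder k k' c c' X y l‖
      ≤ (11 + 22 * |k - k'|) * (timeWeight y * (poleScale k k' X y * ‖l - k‖)) := by
        rcases le_total (‖l - k‖ * poleScale k k' X y) 1 with hsmall | hlarge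
        · refine (h.norm_poleRemainder_le_of_small hy hl₀ hl hsmall).trans ?_
          gcongr
          norm_num
        · refine (h.norm_poleRemainder_le hy hl.le).trans (mul_le_mul (by linarith)
            (le_mul_of_one_le_right hw ?_) hw (by positivity))
          rwa [mul_comm]
    _ = _ := by
        unfold poleBound poleScale
        ring

lemma norm_poleConst_le (h : BalancedResidues k k' c c' X y) :
    ‖(poleConst k k' c c' X y : ℂ)‖ ≤ poleBound k k' * timeWeight y := by
  rw [Complex.norm_real]
  refine h.abs_poleConst_le.trans (mul_le_mul_of_nonneg_right ?_
    (zero_le_one.trans (one_le_timeWeight y)))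
  linarith [le_poleBound k k', abs_nonneg (k - k')]

lemma norm_poleRemainder_le_and_div_le (h : BalancedResidues k k' c c' X y) (hy : y ≠ 0)
    (hl₀ : l ≠ k) (hl : ‖l - k‖ < |k - k'| / 2) :
    ‖poleRemainder k k' c c' X y l‖ ≤ poleBound k k' * timeWeight y ∧
      ‖poleRemainder k k' c c' X y l / (l - k)‖ ≤
        poleBound k k' * timeWeight y * (1 + (|X| + |y|)) := by
  constructor
  · refine (h.norm_poleRemainder_le hy hl.le).trans (mul_le_mul_of_nonneg_right ?_
      (zero_le_one.trans (one_le_timeWeight y)))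
    linarith [le_poleBound k k']
  · rw [norm_div, div_le_iff₀ (norm_pos_iff.2 (sub_ne_zero.2 hl₀))]
    exact h.norm_poleRemainder_le_mul hy hl₀ hl

lemma tendsto_reducedGreen (h : BalancedResidues k k' c c' X y) (hy : y ≠ 0) {z : ℂ}
    (hz : z ≠ 0) :
    Tendsto (fun r : ℝ => reducedGreen k k' c c' X y (k + r * z)) (𝓝[>] 0)
      (𝓝 (poleLeading k k' c c' X y (k + z))) := by
  have hpos : 0 < |k - k'| / 2 := half_pos (abs_pos.2 (sub_ne_zero.2 h.ne))
  have hzero : Tendsto (fun r : ℝ => ‖(r : ℂ) * z‖) (𝓝[>] 0) (𝓝 0) :=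
    tendsto_nhdsWithin_of_tendsto_nhds (Continuous.tendsto' (by fun_prop) _ _ (by simp))
  have hbound := hzero.const_mul (poleBound k k' * timeWeight y * (1 + (|X| + |y|)))
  rw [mul_zero] at hbound
  rw [tendsto_iff_norm_sub_tendsto_zero]
  refine squeeze_zero' (Eventually.of_forall fun _ => norm_nonneg _) ?_ hbound
  filter_upwards [self_mem_nhdsWithin, hzero.eventually_lt_const hpos] with r (hr : 0 < r) hr_near
  have hne : (k : ℂ) + r * z ≠ k := by simpa using ⟨hr.ne', hz⟩
  have hremainder := h.norm_poleRemainder_le_mul hy hne (by rwa [add_sub_cancel_left])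
  rwa [poleRemainder, poleLeading_add_mul hr, add_sub_cancel_left] at hremainder

lemma sign_mul_mul_expPhase_eq (h : BalancedResidues k k' c c' X y) :
    Real.sign (k - k') * c' * expPhase k' X y = Real.sign (k' - k) * c * expPhase k X y := by
  rw [← neg_sub k' k, Real.sign_neg, mul_assoc, h.mul_expPhase_eq_neg]
  ring

lemma poleConst_mul_expPhase (h : BalancedResidues k k' c c' X y) :
    poleConst k' k c' c X y * expPhase k' X y = expPhase k X y * poleConst k k' c c' X y := by
  have hE := (expPhase_pos k X y).ne'
  have hE' := (expPhase_pos k' X y).ne'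
  rw [poleConst, poleConst, sub_mul, h.sign_mul_mul_expPhase_eq, background_swap k' k,
    div_mul_cancel₀ _ hE', mul_sub, mul_div_cancel₀ _ hE]
  ring

/-- Approaching `k'` in the direction `z` corresponds to approaching `k` in the direction `-z`. -/
lemma poleLeading_mul_expPhase (h : BalancedResidues k k' c c' X y) (z : ℂ) :
    poleLeading k' k c' c X y (k' + z) * expPhase k' X y =
      expPhase k X y * poleLeading k k' c c' X y (k + -z) := by
  have hangle : arccotAbs (Real.sign (k - k') * ((k' + z : ℂ).re - k')) (k' + z : ℂ).im =
      arccotAbs (Real.sign (k' - k) * ((k + -z : ℂ).re - k)) (k + -z : ℂ).im := by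
    rw [← neg_sub k' k, Real.sign_neg]
    simp [arccotAbs]
  rw [poleLeading, poleLeading, hangle, add_mul, mul_right_comm, h.poleConst_mul_expPhase,
    h.sign_mul_mul_expPhase_eq]
  ring

end BalancedResidues

/-! ### Residues of the eigenfunctions -/

/-- The share `e^{θ₁} / τ` of the first exponential in the tau function. -/
def share₁ (κ₁ κ₂ a : ℝ) (x : ℝ × ℝ) : ℝ := Real.exp (theta κ₁ x) / tau κ₁ κ₂ a x

/-- The share `a e^{θ₂} / τ` of the second exponential in the tau function. -/
def share₂ (κ₁ κ₂ a : ℝ) (x : ℝ × ℝ) : ℝ := a * Real.exp (theta κ₂ x) / tau κ₁ κ₂ a x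

/-- The residue `χ₁(x) ξ₁(x')` of `χ(x, μ) ξ(x', μ)` at `κ₁`. -/
def residue₁ (κ₁ κ₂ a : ℝ) (x x' : ℝ × ℝ) : ℝ :=
  (κ₁ - κ₂) * (share₂ κ₁ κ₂ a x * share₁ κ₁ κ₂ a x')

/-- The residue `χ₂(x) ξ₂(x')` of `χ(x, μ) ξ(x', μ)` at `κ₂`. -/
def residue₂ (κ₁ κ₂ a : ℝ) (x x' : ℝ × ℝ) : ℝ :=
  (κ₂ - κ₁) * (share₁ κ₁ κ₂ a x * share₂ κ₁ κ₂ a x')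

lemma simpleResidue_mul_polar_add {f g h : ℂ → ℂ} {z A : ℂ} (hg : ContinuousAt g z)
    (hh : ContinuousAt h z) (hf : ∀ᶠ μ in 𝓝[≠] z, f μ = g μ * (A / (μ - z) + h μ)) :
    simpleResidue f z = g z * A := by
  have hcont : ContinuousAt (fun μ => g μ * (A + (μ - z) * h μ)) z := by fun_prop
  have hlim := hcont.tendsto.mono_left (nhdsWithin_le_nhds (s := {z}ᶜ))
  rw [sub_self, zero_mul, add_zero] at hlim
  refine Tendsto.limUnder_eq (hlim.congr' ?_)
  filter_upwards [hf, self_mem_nhdsWithin] with μ hμ hne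
  have hne' : μ - z ≠ 0 := sub_ne_zero.2 hne
  rw [hμ]
  field_simp

lemma phase_sub (μ : ℂ) (x x' : ℝ × ℝ) : phase μ x - phase μ x' =
    μ * ((x.1 - x'.1 : ℝ) : ℂ) + μ ^ 2 * ((x.2 - x'.2 : ℝ) : ℂ) := by
  unfold phase
  push_cast
  ring

lemma ofReal_expPhase_sub (k : ℝ) (x x' : ℝ × ℝ) :
    (expPhase k (x.1 - x'.1) (x.2 - x'.2) : ℂ) = Complex.exp (phase k x - phase k x') := by
  rw [phase_sub, expPhase]
  push_cast
  rfl

section Residues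

variable {κ₁ κ₂ a : ℝ}

lemma tau_pos (ha : 0 < a) (x : ℝ × ℝ) : 0 < tau κ₁ κ₂ a x := by
  unfold tau
  positivity

lemma share₁_add_share₂ (ha : 0 < a) (x : ℝ × ℝ) :
    share₁ κ₁ κ₂ a x + share₂ κ₁ κ₂ a x = 1 := by
  unfold share₁ share₂
  rw [← add_div]
  exact div_self (tau_pos ha x).ne'

lemma share₁_mem_unitInterval (ha : 0 < a) (x : ℝ × ℝ) :
    share₁ κ₁ κ₂ a x ∈ unitInterval := by
  have hτ := tau_pos (κ₁ := κ₁) (κ₂ := κ₂) ha x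
  exact ⟨by unfold share₁; positivity,
    (div_le_one hτ).2 (le_add_of_nonneg_right (by positivity))⟩

lemma share₂_mem_unitInterval (ha : 0 < a) (x : ℝ × ℝ) :
    share₂ κ₁ κ₂ a x ∈ unitInterval := by
  have hτ := tau_pos (κ₁ := κ₁) (κ₂ := κ₂) ha x
  exact ⟨by unfold share₂; positivity,
    (div_le_one hτ).2 (le_add_of_nonneg_left (by positivity))⟩

lemma abs_mul_le_of_mem_unitInterval {t : ℝ} (d : ℝ) (ht : t ∈ unitInterval) : |d * t| ≤ |d| := by
  rw [abs_mul, abs_of_nonneg ht.1]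
  exact mul_le_of_le_one_right (abs_nonneg d) ht.2

/-- The discrete parts of the Green function at `κ₁` and `κ₂` cancel each other. -/
lemma residue_mul_expPhase_cancel (x x' : ℝ × ℝ) :
    residue₁ κ₁ κ₂ a x x' * expPhase κ₁ (x.1 - x'.1) (x.2 - x'.2) +
      residue₂ κ₁ κ₂ a x x' * expPhase κ₂ (x.1 - x'.1) (x.2 - x'.2) = 0 := by
  have hexp (k : ℝ) : expPhase k (x.1 - x'.1) (x.2 - x'.2) =
      Real.exp (theta k x) / Real.exp (theta k x') := by
    unfold expPhase theta
    rw [← Real.exp_sub]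
    congr 1
    ring
  unfold residue₁ residue₂ share₁ share₂
  rw [hexp, hexp]
  field_simp
  ring

lemma balancedResidues (hκ : κ₁ ≠ κ₂) (ha : 0 < a) (x x' : ℝ × ℝ) :
    BalancedResidues κ₁ κ₂ (residue₁ κ₁ κ₂ a x x') (residue₂ κ₁ κ₂ a x x')
      (x.1 - x'.1) (x.2 - x'.2) where
  ne := hκ
  abs_left_le := abs_mul_le_of_mem_unitInterval _
    (unitInterval.mul_mem (share₂_mem_unitInterval ha x) (share₁_mem_unitInterval ha x'))
  abs_right_le := (abs_mul_le_of_mem_unitInterval _ (unitInterval.mul_mem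
    (share₁_mem_unitInterval ha x) (share₂_mem_unitInterval ha x'))).trans_eq (abs_sub_comm _ _)
  cancel := residue_mul_expPhase_cancel x x'

lemma chi_eq (x : ℝ × ℝ) {μ : ℂ} (hμ : μ ≠ 0) :
    chi κ₁ κ₂ a x μ =
      ((μ - κ₁) * share₁ κ₁ κ₂ a x + (μ - κ₂) * share₂ κ₁ κ₂ a x) / μ := by
  unfold chi share₁ share₂
  push_cast
  field_simp

lemma xi_eq (x : ℝ × ℝ) {μ : ℂ} (hμ : μ ≠ 0) :
    xi κ₁ κ₂ a x μ =
      μ * (share₁ κ₁ κ₂ a x / (μ - κ₁) + share₂ κ₁ κ₂ a x / (μ - κ₂)) := by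
  have hfactor (k : ℝ) : 1 - (k : ℂ) / μ = (μ - k) / μ := by field_simp
  unfold xi share₁ share₂
  rw [hfactor, hfactor]
  push_cast
  simp only [div_div_eq_mul_div]
  ring

lemma chi_mul_xi (ha : 0 < a) (x x' : ℝ × ℝ) {μ : ℂ} (hμ : μ ≠ 0) (hμ₁ : μ ≠ κ₁)
    (hμ₂ : μ ≠ κ₂) :
    chi κ₁ κ₂ a x μ * xi κ₁ κ₂ a x' μ =
      twoPole κ₁ κ₂ (residue₁ κ₁ κ₂ a x x') (residue₂ κ₁ κ₂ a x x') μ := by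
  have hshare (x : ℝ × ℝ) : share₂ κ₁ κ₂ a x = 1 - share₁ κ₁ κ₂ a x :=
    eq_sub_of_add_eq' (share₁_add_share₂ ha x)
  have hμ₁' := sub_ne_zero.2 hμ₁
  have hμ₂' := sub_ne_zero.2 hμ₂
  rw [chi_eq x hμ, xi_eq x' hμ, twoPole, residue₁, residue₂, hshare, hshare]
  push_cast
  field_simp
  ring

lemma phi_mul_psi (ha : 0 < a) (x x' : ℝ × ℝ) (r : ℝ) {s : ℝ} (hs : s ≠ 0) :
    phi κ₁ κ₂ a x (r + Complex.I * s) * psi κ₁ κ₂ a x' (r + Complex.I * s) =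
      lineIntegrand κ₁ κ₂ (residue₁ κ₁ κ₂ a x x') (residue₂ κ₁ κ₂ a x x')
        (x.1 - x'.1) (x.2 - x'.2) r s := by
  have hne (k : ℝ) : (r : ℂ) + Complex.I * s ≠ k := fun h =>
    hs (by simpa using congrArg Complex.im h)
  rw [phi, psi, lineIntegrand, ← chi_mul_xi ha x x' (by simpa using hne 0) (hne κ₁) (hne κ₂),
    ← phase_sub, sub_eq_add_neg, Complex.exp_add]
  ring

lemma eventually_psi_eq {k : ℝ} (hk : k ≠ 0) (x : ℝ × ℝ) :
    ∀ᶠ μ in 𝓝[≠] (k : ℂ), psi κ₁ κ₂ a x μ = Complex.exp (-phase μ x) * μ *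
      (share₁ κ₁ κ₂ a x / (μ - κ₁) + share₂ κ₁ κ₂ a x / (μ - κ₂)) := by
  have hne : ∀ᶠ μ : ℂ in 𝓝[≠] (k : ℂ), μ ≠ 0 :=
    nhdsWithin_le_nhds (isOpen_ne.mem_nhds (Complex.ofReal_ne_zero.2 hk))
  filter_upwards [hne] with μ hμ
  rw [psi, xi_eq x hμ, mul_assoc]

lemma continuous_exp_neg_phase_mul (x : ℝ × ℝ) :
    Continuous fun μ : ℂ => Complex.exp (-phase μ x) * μ := by
  unfold phase
  fun_prop

lemma continuousAt_div_sub {k k' : ℝ} (hk : k ≠ k') (B : ℂ) :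
    ContinuousAt (fun μ : ℂ => B / (μ - k')) k :=
  continuousAt_const.div (by fun_prop) (sub_ne_zero.2 (Complex.ofReal_injective.ne hk))

lemma psiAt_left (hκ : κ₁ ≠ κ₂) (hκ₁ : κ₁ ≠ 0) (x : ℝ × ℝ) :
    psiAt κ₁ κ₂ a κ₁ x = Complex.exp (-phase κ₁ x) * κ₁ * share₁ κ₁ κ₂ a x :=
  simpleResidue_mul_polar_add (g := fun μ => Complex.exp (-phase μ x) * μ)
    (continuous_exp_neg_phase_mul x).continuousAt (continuousAt_div_sub hκ _)
    (eventually_psi_eq hκ₁ x)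

lemma psiAt_right (hκ : κ₁ ≠ κ₂) (hκ₂ : κ₂ ≠ 0) (x : ℝ × ℝ) :
    psiAt κ₁ κ₂ a κ₂ x = Complex.exp (-phase κ₂ x) * κ₂ * share₂ κ₁ κ₂ a x :=
  simpleResidue_mul_polar_add (g := fun μ => Complex.exp (-phase μ x) * μ)
    (continuous_exp_neg_phase_mul x).continuousAt (continuousAt_div_sub hκ.symm _)
    ((eventually_psi_eq hκ₂ x).mono fun _ hμ => hμ.trans (by rw [add_comm (_ / _)]))

lemma chiAt_eq (k : ℝ) (x : ℝ × ℝ) : chiAt κ₁ κ₂ a k x = chi κ₁ κ₂ a x k := by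
  rw [chiAt, phiAt, phi, ← mul_assoc, ← Complex.exp_add, neg_add_cancel, Complex.exp_zero,
    one_mul]

lemma chiAt_mul_xiAt_left (hκ : κ₁ ≠ κ₂) (hκ₁ : κ₁ ≠ 0) (x x' : ℝ × ℝ) :
    chiAt κ₁ κ₂ a κ₁ x * xiAt κ₁ κ₂ a κ₁ x' = residue₁ κ₁ κ₂ a x x' := by
  have hκ₁' : (κ₁ : ℂ) ≠ 0 := Complex.ofReal_ne_zero.2 hκ₁
  rw [chiAt_eq, chi_eq x hκ₁', xiAt, psiAt_left hκ hκ₁, ← mul_assoc (Complex.exp _),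
    ← mul_assoc (Complex.exp _), ← Complex.exp_add, add_neg_cancel, Complex.exp_zero, residue₁]
  push_cast
  field_simp
  ring

lemma chiAt_mul_xiAt_right (hκ : κ₁ ≠ κ₂) (hκ₂ : κ₂ ≠ 0) (x x' : ℝ × ℝ) :
    chiAt κ₁ κ₂ a κ₂ x * xiAt κ₁ κ₂ a κ₂ x' = residue₂ κ₁ κ₂ a x x' := by
  have hκ₂' : (κ₂ : ℂ) ≠ 0 := Complex.ofReal_ne_zero.2 hκ₂
  rw [chiAt_eq, chi_eq x hκ₂', xiAt, psiAt_right hκ hκ₂, ← mul_assoc (Complex.exp _),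
    ← mul_assoc (Complex.exp _), ← Complex.exp_add, add_neg_cancel, Complex.exp_zero, residue₂]
  push_cast
  field_simp
  ring

lemma phiAt_mul_psiAt (k : ℝ) (x x' : ℝ × ℝ) :
    phiAt κ₁ κ₂ a k x * psiAt κ₁ κ₂ a k x' =
      chiAt κ₁ κ₂ a k x * xiAt κ₁ κ₂ a k x' * expPhase k (x.1 - x'.1) (x.2 - x'.2) := by
  have hx := Complex.exp_ne_zero (phase k x)
  have hx' := Complex.exp_ne_zero (phase k x')
  rw [chiAt, xiAt, ofReal_expPhase_sub, Complex.exp_sub, Complex.exp_neg]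
  field_simp

end Residues

/-! ### The Green function of the soliton -/

lemma pvIntegral_congr {F H : ℝ → ℂ} (h : ∀ s ≠ 0, F s = H s) : pvIntegral F = pvIntegral H := by
  refine congrArg lim (Filter.map_congr ?_)
  filter_upwards [self_mem_nhdsWithin] with ε hε
  exact setIntegral_congr_fun (measurableSet_lt measurable_const (by fun_prop)) fun s hs =>
    h s (abs_pos.1 (lt_trans hε hs))

section Green

variable {κ₁ κ₂ a : ℝ}

lemma calGreenD_eq (hκ : κ₁ ≠ κ₂) (hκ₁ : κ₁ ≠ 0) (hκ₂ : κ₂ ≠ 0) (x x' : ℝ × ℝ) (l : ℂ) :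
    calGreenD κ₁ κ₂ a x x' l = ((-(heaviside (-(x.2 - x'.2)) * (heaviside (l.re - κ₁) *
      (residue₁ κ₁ κ₂ a x x' * expPhase κ₁ (x.1 - x'.1) (x.2 - x'.2)) +
      heaviside (l.re - κ₂) *
        (residue₂ κ₁ κ₂ a x x' * expPhase κ₂ (x.1 - x'.1) (x.2 - x'.2)))) : ℝ) : ℂ) := by
  rw [calGreenD, mul_assoc (heaviside (l.re - κ₁) : ℂ), mul_assoc (heaviside (l.re - κ₂) : ℂ),
    phiAt_mul_psiAt, phiAt_mul_psiAt, chiAt_mul_xiAt_left hκ hκ₁, chiAt_mul_xiAt_right hκ hκ₂,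
    neg_sub]
  push_cast
  ring

lemma calGreenC_eq (ha : 0 < a) (x x' : ℝ × ℝ) (l : ℂ) :
    calGreenC κ₁ κ₂ a x x' l = ((-(Real.sign (x.2 - x'.2) / Real.pi) *
      expPhase l.re (x.1 - x'.1) (x.2 - x'.2) *
        cutIntegral κ₁ κ₂ (residue₁ κ₁ κ₂ a x x') (residue₂ κ₁ κ₂ a x x')
          (x.1 - x'.1) (x.2 - x'.2) l.re |l.im| : ℝ) : ℂ) := by
  rcases eq_or_ne x.2 x'.2 with hx | hx
  · simp [calGreenC, hx]
  · have hpv := pvIntegral_heaviside_mul_lineIntegrand κ₁ κ₂ (residue₁ κ₁ κ₂ a x x')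
      (residue₂ κ₁ κ₂ a x x') (x.1 - x'.1) l.re |l.im| (sub_ne_zero.2 hx)
    rw [calGreenC, pvIntegral_congr fun s hs => by
      rw [mul_assoc, phi_mul_psi ha x x' l.re hs, ← sq_abs l.im], hpv]
    push_cast
    field_simp

lemma green_eq_reducedGreen (hκ : κ₁ ≠ κ₂) (hκ₁ : κ₁ ≠ 0) (hκ₂ : κ₂ ≠ 0) (ha : 0 < a)
    (x x' : ℝ × ℝ) (l : ℂ) :
    green κ₁ κ₂ a x x' l = reducedGreen κ₁ κ₂ (residue₁ κ₁ κ₂ a x x') (residue₂ κ₁ κ₂ a x x')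
      (x.1 - x'.1) (x.2 - x'.2) l := by
  rw [green, reducedGreen, calGreen, realGreen, calGreenC_eq ha, calGreenD_eq hκ hκ₁ hκ₂,
    ← Complex.ofReal_add, ← sub_eq_add_neg, phase, Prod.fst_sub, Prod.snd_sub]

lemma green_conj (hκ : κ₁ ≠ κ₂) (hκ₁ : κ₁ ≠ 0) (hκ₂ : κ₂ ≠ 0) (ha : 0 < a)
    (x x' : ℝ × ℝ) (l : ℂ) :
    green κ₁ κ₂ a x x' l = starRingEnd ℂ (green κ₁ κ₂ a x x' (starRingEnd ℂ l)) := by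
  rw [green_eq_reducedGreen hκ hκ₁ hκ₂ ha, green_eq_reducedGreen hκ hκ₁ hκ₂ ha,
    reducedGreen_conj, Complex.conj_conj]

end Green

/-! ### Expansion of the Green function at the two poles -/

/-- The function `𝔊₁`, the regular value of the Green function at `κ₁`. -/
def greenConst₁ (κ₁ κ₂ a : ℝ) (x x' : ℝ × ℝ) : ℝ :=
  poleConst κ₁ κ₂ (residue₁ κ₁ κ₂ a x x') (residue₂ κ₁ κ₂ a x x') (x.1 - x'.1) (x.2 - x'.2)

/-- The function `𝔊₂`, the regular value of the Green function at `κ₂`. -/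
def greenConst₂ (κ₁ κ₂ a : ℝ) (x x' : ℝ × ℝ) : ℝ :=
  poleConst κ₂ κ₁ (residue₂ κ₁ κ₂ a x x') (residue₁ κ₁ κ₂ a x x') (x.1 - x'.1) (x.2 - x'.2)

/-- The function `ω₁`, the remainder in the expansion of the Green function about `κ₁`. -/
def greenRemainder₁ (κ₁ κ₂ a : ℝ) (x x' : ℝ × ℝ) (l : ℂ) : ℂ :=
  poleRemainder κ₁ κ₂ (residue₁ κ₁ κ₂ a x x') (residue₂ κ₁ κ₂ a x x')
    (x.1 - x'.1) (x.2 - x'.2) l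

/-- The function `ω₂`, the remainder in the expansion of the Green function about `κ₂`. -/
def greenRemainder₂ (κ₁ κ₂ a : ℝ) (x x' : ℝ × ℝ) (l : ℂ) : ℂ :=
  poleRemainder κ₂ κ₁ (residue₂ κ₁ κ₂ a x x') (residue₁ κ₁ κ₂ a x x')
    (x.1 - x'.1) (x.2 - x'.2) l

lemma dist₁_eq (x x' : ℝ × ℝ) : dist₁ x x' = |x.1 - x'.1| + |x.2 - x'.2| := by
  rw [dist₁, abs_sub_comm, abs_sub_comm x'.2]

lemma ofReal_expPhase_sub_eq_exp (k : ℝ) (x x' : ℝ × ℝ) :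
    (expPhase k (x.1 - x'.1) (x.2 - x'.2) : ℂ) =
      Complex.exp (k * (x.1 - x'.1) + k ^ 2 * (x.2 - x'.2)) := by
  unfold expPhase
  push_cast
  rfl

lemma exp_I_mul_pi_add (α : ℝ) :
    Complex.exp (Complex.I * (Real.pi + α)) = -Complex.exp (Complex.I * α) := by
  rw [mul_add, Complex.exp_add, mul_comm Complex.I (Real.pi : ℂ), Complex.exp_pi_mul_I, neg_one_mul]

lemma ne_of_mem_puncturedDisc {κ₁ κ₂ k : ℝ} {l : ℂ} (hl : l ∈ puncturedDisc κ₁ κ₂ k) : l ≠ k :=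
  sub_ne_zero.1 (norm_pos_iff.1 hl.1)

lemma norm_sub_lt_of_mem_puncturedDisc {κ₁ κ₂ k : ℝ} {l : ℂ} (hl : l ∈ puncturedDisc κ₁ κ₂ k) :
    ‖l - k‖ < |κ₁ - κ₂| / 2 := by
  refine hl.2.trans_le (div_le_div_of_nonneg_right ?_ zero_le_two)
  rw [abs_sub_comm]
  exact (min_le_right _ _).trans (le_abs_self _)

section Expansion

variable {κ₁ κ₂ a : ℝ} {x x' : ℝ × ℝ} {l : ℂ}

lemma green_eq_at_lower (hκ : κ₁ < κ₂) (hκ₁ : κ₁ ≠ 0) (hκ₂ : κ₂ ≠ 0) (ha : 0 < a)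
    (x x' : ℝ × ℝ) (l : ℂ) :
    green κ₁ κ₂ a x x' l =
      greenConst₁ κ₁ κ₂ a x x' + (1 / Real.pi : ℝ) * chiAt κ₁ κ₂ a κ₁ x *
        xiAt κ₁ κ₂ a κ₁ x' * (arccotAbs (l.re - κ₁) l.im : ℝ) +
      greenRemainder₁ κ₁ κ₂ a x x' l := by
  rw [mul_assoc (_ : ℂ) (chiAt κ₁ κ₂ a κ₁ x), chiAt_mul_xiAt_left hκ.ne hκ₁,
    green_eq_reducedGreen hκ.ne hκ₁ hκ₂ ha, greenRemainder₁, greenConst₁, poleRemainder,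
    poleLeading, Real.sign_of_pos (sub_pos.2 hκ), one_mul, one_mul]
  push_cast
  ring

lemma green_eq_at_upper (hκ : κ₁ < κ₂) (hκ₁ : κ₁ ≠ 0) (hκ₂ : κ₂ ≠ 0) (ha : 0 < a)
    (x x' : ℝ × ℝ) (l : ℂ) :
    green κ₁ κ₂ a x x' l =
      greenConst₂ κ₁ κ₂ a x x' - (1 / Real.pi : ℝ) * chiAt κ₁ κ₂ a κ₂ x *
        xiAt κ₁ κ₂ a κ₂ x' * (arccotAbs (κ₂ - l.re) l.im : ℝ) +
      greenRemainder₂ κ₁ κ₂ a x x' l := by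
  rw [mul_assoc (_ : ℂ) (chiAt κ₁ κ₂ a κ₂ x), chiAt_mul_xiAt_right hκ.ne hκ₂,
    green_eq_reducedGreen hκ.ne hκ₁ hκ₂ ha, reducedGreen_swap, greenRemainder₂, greenConst₂,
    poleRemainder, poleLeading, Real.sign_of_neg (sub_neg.2 hκ), neg_one_mul, neg_one_mul,
    neg_sub]
  push_cast
  ring

lemma norm_greenConst₁_le (hκ : κ₁ ≠ κ₂) (ha : 0 < a) (x x' : ℝ × ℝ) :
    ‖(greenConst₁ κ₁ κ₂ a x x' : ℂ)‖ ≤ poleBound κ₁ κ₂ * weight x x' :=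
  (balancedResidues hκ ha x x').norm_poleConst_le

lemma norm_greenConst₂_le (hκ : κ₁ ≠ κ₂) (ha : 0 < a) (x x' : ℝ × ℝ) :
    ‖(greenConst₂ κ₁ κ₂ a x x' : ℂ)‖ ≤ poleBound κ₁ κ₂ * weight x x' := by
  rw [poleBound_comm]
  exact (balancedResidues hκ ha x x').symm.norm_poleConst_le

lemma norm_greenRemainder₁_le (hκ : κ₁ ≠ κ₂) (ha : 0 < a) (hx : x.2 ≠ x'.2)
    (hl : l ∈ puncturedDisc κ₁ κ₂ κ₁) :
    ‖greenRemainder₁ κ₁ κ₂ a x x' l‖ ≤ poleBound κ₁ κ₂ * weight x x' ∧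
      ‖greenRemainder₁ κ₁ κ₂ a x x' l / (l - κ₁)‖ ≤
        poleBound κ₁ κ₂ * weight x x' * (1 + dist₁ x x') := by
  rw [dist₁_eq]
  exact (balancedResidues hκ ha x x').norm_poleRemainder_le_and_div_le (sub_ne_zero.2 hx)
    (ne_of_mem_puncturedDisc hl) (norm_sub_lt_of_mem_puncturedDisc hl)

lemma norm_greenRemainder₂_le (hκ : κ₁ ≠ κ₂) (ha : 0 < a) (hx : x.2 ≠ x'.2)
    (hl : l ∈ puncturedDisc κ₁ κ₂ κ₂) :
    ‖greenRemainder₂ κ₁ κ₂ a x x' l‖ ≤ poleBound κ₁ κ₂ * weight x x' ∧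
      ‖greenRemainder₂ κ₁ κ₂ a x x' l / (l - κ₂)‖ ≤
        poleBound κ₁ κ₂ * weight x x' * (1 + dist₁ x x') := by
  rw [dist₁_eq, poleBound_comm]
  exact (balancedResidues hκ ha x x').symm.norm_poleRemainder_le_and_div_le (sub_ne_zero.2 hx)
    (ne_of_mem_puncturedDisc hl) (abs_sub_comm κ₁ κ₂ ▸ norm_sub_lt_of_mem_puncturedDisc hl)

lemma greenConst₂_mul_exp (hκ : κ₁ ≠ κ₂) (ha : 0 < a) (x x' : ℝ × ℝ) :
    greenConst₂ κ₁ κ₂ a x x' * Complex.exp (κ₂ * (x.1 - x'.1) + κ₂ ^ 2 * (x.2 - x'.2)) =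
      Complex.exp (κ₁ * (x.1 - x'.1) + κ₁ ^ 2 * (x.2 - x'.2)) * greenConst₁ κ₁ κ₂ a x x' := by
  rw [← ofReal_expPhase_sub_eq_exp, ← ofReal_expPhase_sub_eq_exp]
  exact_mod_cast (balancedResidues hκ ha x x').poleConst_mul_expPhase

lemma exists_tendsto_green_along_opposite_rays (hκ : κ₁ ≠ κ₂) (hκ₁ : κ₁ ≠ 0) (hκ₂ : κ₂ ≠ 0)
    (ha : 0 < a) (hx : x.2 ≠ x'.2) (α : ℝ) :
    ∃ L₁ L₂ : ℂ,
      Tendsto (fun r : ℝ =>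
        green κ₁ κ₂ a x x' (κ₁ + r * Complex.exp (Complex.I * (Real.pi + α))))
        (𝓝[>] 0) (𝓝 L₁) ∧
      Tendsto (fun r : ℝ =>
        green κ₁ κ₂ a x x' (κ₂ + r * Complex.exp (Complex.I * α))) (𝓝[>] 0) (𝓝 L₂) ∧
      L₂ * Complex.exp (κ₂ * (x.1 - x'.1) + κ₂ ^ 2 * (x.2 - x'.2)) =
        Complex.exp (κ₁ * (x.1 - x'.1) + κ₁ ^ 2 * (x.2 - x'.2)) * L₁ := by
  have h := balancedResidues hκ ha x x'
  have hz := Complex.exp_ne_zero (Complex.I * α)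
  have hlower := h.tendsto_reducedGreen (sub_ne_zero.2 hx) (neg_ne_zero.2 hz)
  have hupper := h.symm.tendsto_reducedGreen (sub_ne_zero.2 hx) hz
  simp only [reducedGreen_swap κ₂ κ₁, ← green_eq_reducedGreen hκ hκ₁ hκ₂ ha] at hlower hupper
  rw [← exp_I_mul_pi_add] at hlower
  refine ⟨_, _, hlower, hupper, ?_⟩
  rw [← ofReal_expPhase_sub_eq_exp, ← ofReal_expPhase_sub_eq_exp, exp_I_mul_pi_add]
  exact_mod_cast h.poleLeading_mul_expPhase _

end Expansion

end KPGreen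

end

theorem mainTheorem6 (κ₁ κ₂ a : ℝ) (hκ : κ₁ < κ₂) (hκ₁ : κ₁ ≠ 0) (hκ₂ : κ₂ ≠ 0) (ha : 0 < a) :
    (∀ (x x' : ℝ × ℝ) (l : ℂ),
      green κ₁ κ₂ a x x' l = starRingEnd ℂ (green κ₁ κ₂ a x x' (starRingEnd ℂ l))) ∧
    ∃ (g₁ g₂ : ℝ × ℝ → ℝ × ℝ → ℂ) (ω₁ ω₂ : ℝ × ℝ → ℝ × ℝ → ℂ → ℂ) (C : ℝ),
      ∀ x x' : ℝ × ℝ, x.2 ≠ x'.2 →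
        (∀ l ∈ puncturedDisc κ₁ κ₂ κ₁,
          green κ₁ κ₂ a x x' l =
            g₁ x x' + (1 / Real.pi : ℝ) * chiAt κ₁ κ₂ a κ₁ x * xiAt κ₁ κ₂ a κ₁ x' *
              (arccotAbs (l.re - κ₁) l.im : ℝ) + ω₁ x x' l) ∧
        (∀ l ∈ puncturedDisc κ₁ κ₂ κ₂,
          green κ₁ κ₂ a x x' l =
            g₂ x x' - (1 / Real.pi : ℝ) * chiAt κ₁ κ₂ a κ₂ x * xiAt κ₁ κ₂ a κ₂ x' *
              (arccotAbs (κ₂ - l.re) l.im : ℝ) + ω₂ x x' l) ∧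
        ‖g₁ x x'‖ ≤ C * weight x x' ∧
        ‖g₂ x x'‖ ≤ C * weight x x' ∧
        (∀ l ∈ puncturedDisc κ₁ κ₂ κ₁,
          ‖ω₁ x x' l‖ ≤ C * weight x x' ∧
          ‖ω₁ x x' l / (l - κ₁)‖ ≤ C * weight x x' * (1 + dist₁ x x')) ∧
        (∀ l ∈ puncturedDisc κ₁ κ₂ κ₂,
          ‖ω₂ x x' l‖ ≤ C * weight x x' ∧
          ‖ω₂ x x' l / (l - κ₂)‖ ≤ C * weight x x' * (1 + dist₁ x x')) ∧
        g₂ x x' * Complex.exp (κ₂ * (x.1 - x'.1) + κ₂ ^ 2 * (x.2 - x'.2)) =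
          Complex.exp (κ₁ * (x.1 - x'.1) + κ₁ ^ 2 * (x.2 - x'.2)) * g₁ x x' ∧
        ∀ α : ℝ, ∃ L₁ L₂ : ℂ,
          Tendsto (fun r : ℝ =>
            green κ₁ κ₂ a x x' (κ₁ + r * Complex.exp (Complex.I * (Real.pi + α))))
            (𝓝[>] 0) (𝓝 L₁) ∧
          Tendsto (fun r : ℝ =>
            green κ₁ κ₂ a x x' (κ₂ + r * Complex.exp (Complex.I * α))) (𝓝[>] 0) (𝓝 L₂) ∧
          L₂ * Complex.exp (κ₂ * (x.1 - x'.1) + κ₂ ^ 2 * (x.2 - x'.2)) =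
            Complex.exp (κ₁ * (x.1 - x'.1) + κ₁ ^ 2 * (x.2 - x'.2)) * L₁ := by
  refine ⟨green_conj hκ.ne hκ₁ hκ₂ ha,
    fun x x' => greenConst₁ κ₁ κ₂ a x x', fun x x' => greenConst₂ κ₁ κ₂ a x x',
    greenRemainder₁ κ₁ κ₂ a, greenRemainder₂ κ₁ κ₂ a, poleBound κ₁ κ₂, fun x x' hx => ?_⟩
  exact ⟨fun l _ => green_eq_at_lower hκ hκ₁ hκ₂ ha x x' l,
    fun l _ => green_eq_at_upper hκ hκ₁ hκ₂ ha x x' l,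
    norm_greenConst₁_le hκ.ne ha x x',
    norm_greenConst₂_le hκ.ne ha x x',
    fun _ hl => norm_greenRemainder₁_le hκ.ne ha hx hl,
    fun _ hl => norm_greenRemainder₂_le hκ.ne ha hx hl,
    greenConst₂_mul_exp hκ.ne ha x x',
    exists_tendsto_green_along_opposite_rays hκ.ne hκ₁ hκ₂ ha hx⟩
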